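/- Let $H=(V,E)$ be a finite undirected multigraph (parallel edges allowed) with a set $U\subseteq E$ of unsafe edges; the edges of $E\setminus U$ are safe. For $S\subseteq V$ let $\delta(S)$ be the set of edges with exactly one end in $S$. For integers $k,q$, the graph $H$ is $(k,q)$-flex-connected if for every $\emptyset\neq S\subsetneq V$ the cut $\delta(S)$ contains at least $k$ safe edges or at least $k+q$ edges. Let $$\mathcal F_2(H)=\{\emptyset\ne S\subsetneq V:\ |\delta(S)|=k+1,\ |\delta(S)\cap U|\ge 2\}.$$ Sets $A,B\subseteq V$ cross if $A\cap B$, $A\setminus B$, $B\setminus A$ and $V\setminus(A\cup B)$ are all non-empty. A family $\mathcal F$ of subsets of $V$ is uncrossable if for all $A,B\in\mathcal F$ either $A\cap B,A\cup B\in\mathcal F$ or $A\setminus B,B\setminus A\in\mathcal F$; it is symmetric if $S\in\mathcal F$ implies $V\setminus S\in\mathcal F$; it is a proper crossing family if $A\cap B,A\cup B\in\mathcal F$ and $(A\setminus B)\cup(B\setminus A)\notin\mathcal F$ for all crossing $A,B\in\mathcal F$. Lemma. There is a polynomial-time algorithm that, given $H$, $U$ and an odd integer $k\geq 1$ such that $H$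 is $(k,1)$-flex-connected, lists the members of two families $\mathcal F',\mathcal F''$ such that $\mathcal F'\cup\mathcal F''=\mathcal F_2(H)$, the family $\mathcal F'$ is uncrossable, and $\mathcal F''$ is a symmetric proper crossing family. Moreover, the families have the following property. For crossing $A,B\in\mathcal F_2(H)$ consider the quotient graph of $\{A,B\}$, which is obtained by shrinking each of $A\cap B$, $A\setminus B$, $B\setminus A$, $V\setminus(A\cup B)$ into a single node and merging parallel edges; call an edge of it red if it represents at least two unsafe edges of $H$, and blue if it represents exactly one. If $A\in\mathcal F'$ and $B\in\mathcal F_2(H)$ cross, then at least one of the two side edges of this quotient graph in the cut of $A$ (the edge between $A\cap B$ and $B\setminus A$ and the edge between $A\setminus B$ and $V\setminus(A\cup B)$) is red. If $A\in\mathcal F''$, then $\delta(A)$ contains exactly two unsafe edges, and for every $B\in\mathcal F_2(H)$ that crosses $A$ the cut of $A$ in this quotient graph consists of these two side edges, and both are blue. -/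

import Mathlib

open Finset

namespace FlexCut

section Families

variable {V : Type*} [Fintype V] [DecidableEq V]

/-- Two sets cross when all four corner sets are non-empty. -/
def Cross (A B : Finset V) : Prop :=
  (A ∩ B).Nonempty ∧ (A \ B).Nonempty ∧ (B \ A).Nonempty ∧ ((A ∪ B)ᶜ).Nonempty

/-- Uncrossable family. -/
def Uncrossable (F : Set (Finset V)) : Prop :=
  ∀ A ∈ F, ∀ B ∈ F, (A ∩ B ∈ F ∧ A ∪ B ∈ F) ∨ (A \ B ∈ F ∧ B \ A ∈ F)

/-- Symmetric family: closed under complements. -/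
def SymmetricFamily (F : Set (Finset V)) : Prop :=
  ∀ S ∈ F, Sᶜ ∈ F

/-- Crossing family. -/
def CrossingFamily (F : Set (Finset V)) : Prop :=
  ∀ A ∈ F, ∀ B ∈ F, Cross A B → A ∩ B ∈ F ∧ A ∪ B ∈ F

/-- Proper crossing family. -/
def ProperCrossingFamily (F : Set (Finset V)) : Prop :=
  CrossingFamily F ∧ ∀ A ∈ F, ∀ B ∈ F, Cross A B → (A \ B) ∪ (B \ A) ∉ F

end Families

/-- A finite multigraph with node set `V` and edge set `E`, in which the edges of `U` are the
not-safe ones. The ends of an edge are listed in an arbitrary order, which plays no role below.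
Parallel edges are allowed; loops are allowed too and lie in no cut. -/
structure Network (V E : Type*) where
  src : E → V
  tgt : E → V
  U : Finset E

namespace Network

variable {V E : Type*} [Fintype V] [DecidableEq V] [Fintype E] [DecidableEq E]

/-- The edges with one end in `X` and the other end in `Y` (used for disjoint `X`, `Y`). -/
def between (H : Network V E) (X Y : Finset V) : Finset E :=
  univ.filter fun e => (H.src e ∈ X ∧ H.tgt e ∈ Y) ∨ (H.src e ∈ Y ∧ H.tgt e ∈ X)

/-- The cut defined by `S`. -/
def cut (H : Network V E) (S : Finset V) : Finset E :=
  H.between S Sᶜ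

/-- `H` is `(k,q)`-flex-connected: every cut has at least `k` safe edges or at least `k + q`
edges. -/
def FlexConnected (H : Network V E) (k q : ℕ) : Prop :=
  ∀ S : Finset V, S.Nonempty → S ≠ univ → k ≤ #(H.cut S \ H.U) ∨ k + q ≤ #(H.cut S)

/-- The family `F_q(H)` of the sets `∅ ≠ S ⊊ V` whose cut has exactly `k + q - 1` edges, at least
`q` of them not safe. -/
def tightCuts (H : Network V E) (k q : ℕ) : Set (Finset V) :=
  {S | S.Nonempty ∧ S ≠ univ ∧ #(H.cut S) + 1 = k + q ∧ q ≤ #(H.cut S ∩ H.U)}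

/-- The number of not-safe edges between `X` and `Y`, that is, the number of such edges
represented by the edge `XY` of a quotient graph having `X` and `Y` as nodes. -/
def weight (H : Network V E) (X Y : Finset V) : ℕ :=
  #(H.between X Y ∩ H.U)

/-- In the quotient graph of `{A, B}`, whose nodes are the four corner sets, one of the two side
edges in the cut of `A` is red (represents at least two not-safe edges). -/
def HasRedSide (H : Network V E) (A B : Finset V) : Prop :=
  2 ≤ H.weight (A ∩ B) (B \ A) ∨ 2 ≤ H.weight (A \ B) (A ∪ B)ᶜ

/-- In the quotient graph of `{A, B}`, the cut of `A` consists of its two side edges, and both are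
blue (represent exactly one not-safe edge). -/
def TwoBlueSides (H : Network V E) (A B : Finset V) : Prop :=
  H.cut A = H.between (A ∩ B) (B \ A) ∪ H.between (A \ B) (A ∪ B)ᶜ ∧
    H.weight (A ∩ B) (B \ A) = 1 ∧ H.weight (A \ B) (A ∪ B)ᶜ = 1

end Network

/-! The model of computation: programs over binary trees. Every step is charged the size of the
tree it works on, so the cost bounds the size of all the data that is produced, and a run is
simulated by a Turing machine with polynomial slowdown. -/

/-- Binary trees, the only data type. -/
inductive Data : Type
  | nil : Data
  | node (l r : Data) : Data

namespace Data

/-- The number of nodes, leaves included. -/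
def size : Data → ℕ
  | nil => 1
  | node l r => l.size + r.size + 1

/-- Left subtree. -/
def left : Data → Data
  | nil => nil
  | node l _ => l

/-- Right subtree. -/
def right : Data → Data
  | nil => nil
  | node _ r => r

/-- Natural numbers, in unary. -/
def ofNat : ℕ → Data
  | 0 => nil
  | n + 1 => node nil (ofNat n)

/-- Truth values. -/
def ofBool : Bool → Data
  | false => nil
  | true => node nil nil

/-- Lists. -/
def ofList : List Data → Data
  | [] => nil
  | a :: l => node a (ofList l)

/-- A subset of `{0, …, n - 1}`, as its list of `n` membership bits. -/
def ofFinset {n : ℕ} (S : Finset (Fin n)) : Data :=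
  ofList (List.ofFn fun v : Fin n => ofBool (decide (v ∈ S)))

/-- A list of subsets of `{0, …, n - 1}`. -/
def ofFamily {n : ℕ} (L : List (Finset (Fin n))) : Data :=
  ofList (L.map ofFinset)

/-- The instance `(H, k)`: the number of nodes, the number `k`, and the list of the edges, each
with its two ends and a bit telling whether it belongs to `U`. -/
def ofInstance {n m : ℕ} (H : Network (Fin n) (Fin m)) (k : ℕ) : Data :=
  node (ofNat n) (node (ofNat k) (ofList (List.ofFn fun e : Fin m =>
    node (ofNat (H.src e)) (node (ofNat (H.tgt e)) (ofBool (decide (e ∈ H.U)))))))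

end Data

/-- Programs. Each one maps a tree to a tree; `nil` counts as false in tests. -/
inductive Prog : Type
  /-- return the input -/
  | skip : Prog
  /-- return the one-leaf tree -/
  | nil : Prog
  /-- return the left subtree -/
  | left : Prog
  /-- return the right subtree -/
  | right : Prog
  /-- run both programs on the input and join the results -/
  | join (p q : Prog) : Prog
  /-- run `p`, then `q` on its result -/
  | seq (p q : Prog) : Prog
  /-- if `c` holds of the input run `p` on the input, otherwise run `q` on it -/
  | ite (c p q : Prog) : Prog
  /-- while `c` holds of the current tree, replace the tree by the result of `p` -/
  | loop (c p : Prog) : Prog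

/-- `Run p x y t`: the program `p` halts on the input `x` with the output `y`, at cost `t`. -/
inductive Run : Prog → Data → Data → ℕ → Prop
  | skip (x : Data) : Run .skip x x x.size
  | nil (x : Data) : Run .nil x .nil x.size
  | left (x : Data) : Run .left x x.left x.size
  | right (x : Data) : Run .right x x.right x.size
  | join {p q : Prog} {x y z : Data} {s t : ℕ} :
      Run p x y s → Run q x z t → Run (.join p q) x (.node y z) (s + t + x.size)
  | seq {p q : Prog} {x y z : Data} {s t : ℕ} :
      Run p x y s → Run q y z t → Run (.seq p q) x z (s + t + x.size)
  | ite_true {c p q : Prog} {x y a b : Data} {s t : ℕ} :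
      Run c x (.node a b) s → Run p x y t → Run (.ite c p q) x y (s + t + x.size)
  | ite_false {c p q : Prog} {x y : Data} {s t : ℕ} :
      Run c x .nil s → Run q x y t → Run (.ite c p q) x y (s + t + x.size)
  | loop_done {c p : Prog} {x : Data} {s : ℕ} :
      Run c x .nil s → Run (.loop c p) x x (s + x.size)
  | loop_step {c p : Prog} {x y z a b : Data} {s t r : ℕ} :
      Run c x (.node a b) s → Run p x y t → Run (.loop c p) y z r →
        Run (.loop c p) x z (s + t + r + x.size)

/-- Programs are deterministic, so output and cost are functions of program and input. -/
theorem Run.unique {p : Prog} {x y y' : Data} {t t' : ℕ} (h : Run p x y t)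
    (h' : Run p x y' t') : y = y' ∧ t = t' := by
  induction h generalizing y' t' with
  | skip x => cases h'; exact ⟨rfl, rfl⟩
  | nil x => cases h'; exact ⟨rfl, rfl⟩
  | left x => cases h'; exact ⟨rfl, rfl⟩
  | right x => cases h'; exact ⟨rfl, rfl⟩
  | join _ _ ih₁ ih₂ =>
    cases h' with
    | join a b =>
      obtain ⟨rfl, rfl⟩ := ih₁ a
      obtain ⟨rfl, rfl⟩ := ih₂ b
      exact ⟨rfl, rfl⟩
  | seq _ _ ih₁ ih₂ =>
    cases h' with
    | seq a b =>
      obtain ⟨rfl, rfl⟩ := ih₁ a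
      obtain ⟨rfl, rfl⟩ := ih₂ b
      exact ⟨rfl, rfl⟩
  | ite_true _ _ ih₁ ih₂ =>
    cases h' with
    | ite_true a b =>
      obtain ⟨-, rfl⟩ := ih₁ a
      obtain ⟨rfl, rfl⟩ := ih₂ b
      exact ⟨rfl, rfl⟩
    | ite_false a b => exact absurd (ih₁ a).1 (by simp)
  | ite_false _ _ ih₁ ih₂ =>
    cases h' with
    | ite_true a b => exact absurd (ih₁ a).1 (by simp)
    | ite_false a b =>
      obtain ⟨-, rfl⟩ := ih₁ a
      obtain ⟨rfl, rfl⟩ := ih₂ b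
      exact ⟨rfl, rfl⟩
  | loop_done _ ih =>
    cases h' with
    | loop_done a =>
      obtain ⟨-, rfl⟩ := ih a
      exact ⟨rfl, rfl⟩
    | loop_step a b c => exact absurd (ih a).1 (by simp)
  | loop_step _ _ _ ih₁ ih₂ ih₃ =>
    cases h' with
    | loop_done a => exact absurd (ih₁ a).1 (by simp)
    | loop_step a b c =>
      obtain ⟨-, rfl⟩ := ih₁ a
      obtain ⟨rfl, rfl⟩ := ih₂ b
      obtain ⟨rfl, rfl⟩ := ih₃ c
      exact ⟨rfl, rfl⟩

end FlexCut

/-! ### Sizes of codes. -/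

namespace FlexCut

/-! Combinatorics. Put q = (k+1)/2. Every non-trivial cut has at least k edges, and a cut of exactly
k edges contains only safe ones. Let A and B be crossing members of the family. Two adjacent corners
cannot both have degree k, because their cuts together contain all of δ(A) or all of δ(B). So some
opposite pair of corners has both degrees at least k+1. Counting makes them equal to k+1 and makes
the other two degrees even, hence at least k+1 as well, since k is odd. It follows that no edge
joins opposite corners and each of the four sides has exactly q edges (`square_arith`,
`FlexConnected.square`).

Suppose moreover that A crosses B and C, and that B divides the side of δ(A) inside C. Then the
three cuts form a cube. Its four cells in A have total degree 6q = 3k+3, and each has degree at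
least k, so k ≤ 3. A divided side has q ≥ 2, so k = 3, all four cells have degree k, and δ(A) has no
unsafe edge, which is impossible (`FlexConnected.not_cube`). As a consequence, a tight cut crossing
a tight corner A ∩ B does not divide the sides bounding that corner (`FlexConnected.not_divides`).

Take for F' the sets having a red side against every member they cross, and for F'' the sets with
two unsafe edges having a red side against none. If A has no red side against B, each side of δ(A)
has one unsafe edge; a C with both of them on one side would give a forbidden cube. So all partners
of A agree, and F' and F'' cover the family. Both end corners of a red side lie in F', since the
side stays undivided. A red side in δ(A) and one in δ(B) together meet three corners, hence an
opposite pair, so F' is uncrossable. The corners of two members of F'' lie in F'' by a similar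
count, and the symmetric difference has 2k+2 edges, too many.

Algorithm. It suffices to list polynomially many sets including all those with at most k+1 cut
edges; the rest is filtering. With m edges, pack km spanning trees greedily, each of minimum total
load, where the load of an edge counts the earlier trees using it. The potential ∑ 2^load grows by a
factor of at most 1 + 2/k per round (`Robust.potential_forest`), so all loads stay at most 4m, and
some tree meets a given cut of at most k+1 edges at most 8 times (`exists_tree`). Up to complement,
the set is then the symmetric difference of at most 8 fundamental cuts of that tree
(`IsTree.mem_sums`).

The running time is handled by a calculus of polynomial-time functions whose only form of iteration
is a fold over a list with a bounded accumulator (`PolyTime.foldl`). -/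

theorem Run.size_le {P : Prog} {x y : Data} {t : ℕ} (h : Run P x y t) : y.size ≤ t := by
  induction h with
  | left x => cases x <;> simp [Data.left, Data.size]; omega
  | right x => cases x <;> simp [Data.right, Data.size]; omega
  | nil x => cases x <;> simp [Data.size]
  | skip x => exact le_rfl
  | @join _ _ x _ _ _ _ _ _ h₁ h₂ =>
    have : 1 ≤ x.size := by cases x <;> simp [Data.size]
    simp only [Data.size]; omega
  | _ => omega

theorem Data.one_le_size (x : Data) : 1 ≤ x.size := by cases x <;> simp [Data.size]

/-- Types whose elements are represented by trees. -/
class Coded (α : Type) where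
  code : α → Data

instance : Coded Unit := ⟨fun _ => .nil⟩
instance : Coded ℕ := ⟨Data.ofNat⟩
instance : Coded Bool := ⟨Data.ofBool⟩
instance {α β : Type} [Coded α] [Coded β] : Coded (α × β) :=
  ⟨fun x => .node (Coded.code x.1) (Coded.code x.2)⟩
instance {α : Type} [Coded α] : Coded (List α) := ⟨fun l => .ofList (l.map Coded.code)⟩

open Coded

/-- The size of the tree representing an object. -/
def csize {α : Type} [Coded α] (a : α) : ℕ := (code a).size

section

variable {α β γ σ : Type} [Coded α] [Coded β] [Coded γ] [Coded σ]

theorem one_le_csize (a : α) : 1 ≤ csize a := Data.one_le_size _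

theorem csize_pair (a : α) (b : β) : csize (a, b) = csize a + csize b + 1 := rfl

@[simp] theorem csize_nil : csize ([] : List α) = 1 := rfl

@[simp] theorem csize_cons (a : α) (l : List α) : csize (a :: l) = csize a + csize l + 1 := rfl

@[simp] theorem csize_nat (n : ℕ) : csize n = 2 * n + 1 := by
  induction n with
  | zero => rfl
  | succ n ih =>
    have : csize (n + 1) = 1 + csize n + 1 := rfl
    omega

theorem length_lt_csize (l : List α) : l.length < csize l := by
  induction l with
  | nil => simp
  | cons a l ih => simp only [List.length_cons, csize_cons]; omega

theorem csize_append (l₁ l₂ : List α) : csize (l₁ ++ l₂) + 1 = csize l₁ + csize l₂ := by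
  induction l₁ with
  | nil => simp; omega
  | cons a l ih => simp only [List.cons_append, csize_cons]; omega

theorem csize_reverse (l : List α) : csize l.reverse = csize l := by
  induction l with
  | nil => rfl
  | cons a l ih =>
    have := csize_append l.reverse [a]
    simp only [List.reverse_cons, csize_cons, csize_nil] at *
    omega

theorem csize_perm {l₁ l₂ : List α} (h : l₁.Perm l₂) : csize l₁ = csize l₂ := by
  induction h with
  | nil => rfl
  | cons a _ ih => simp [ih]
  | swap a b l => simp; omega
  | trans _ _ h₁ h₂ => exact h₁.trans h₂

theorem csize_sublist {l₁ l₂ : List α} (h : l₁.Sublist l₂) : csize l₁ ≤ csize l₂ := by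
  induction h with
  | slnil => rfl
  | cons a _ ih => simp only [csize_cons]; omega
  | cons_cons a _ ih => simp only [csize_cons]; omega

theorem csize_mem {a : α} {l : List α} (h : a ∈ l) : csize a ≤ csize l := by
  induction l with
  | nil => cases h
  | cons b l ih =>
    rw [csize_cons]
    rcases List.mem_cons.1 h with rfl | h
    · omega
    · have := ih h; omega

theorem csize_list_le {l : List α} {M N : ℕ} (hl : l.length ≤ N) (h : ∀ a ∈ l, csize a ≤ M) :
    csize l ≤ N * (M + 1) + 1 := by
  have : csize l ≤ l.length * (M + 1) + 1 := by
    clear hl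
    induction l with
    | nil => simp
    | cons a l ih =>
      have h₁ := h a (by simp)
      have h₂ := ih fun b hb => h b (by simp [hb])
      rw [csize_cons, List.length_cons, Nat.succ_mul]; omega
  exact this.trans (by gcongr)

theorem eval_mono (p : Polynomial ℕ) {a b : ℕ} (h : a ≤ b) : p.eval a ≤ p.eval b := by
  induction p using Polynomial.induction_on' with
  | add p q hp hq => simp only [Polynomial.eval_add]; omega
  | monomial n c => simp only [Polynomial.eval_monomial]; gcongr

/-! ### Calculus of polynomial-time functions. -/

/-- Functions bounded by a polynomial in the size of the argument. -/
@[fun_prop]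
def PolyBounded (g : α → ℕ) : Prop :=
  ∃ p : Polynomial ℕ, ∀ a, g a ≤ p.eval (csize a)

/-- Functions computed by a program in polynomial time. -/
@[fun_prop]
def PolyTime (f : α → β) : Prop :=
  ∃ (P : Prog) (p : Polynomial ℕ), ∀ a, ∃ t, Run P (code a) (code (f a)) t ∧ t ≤ p.eval (csize a)

namespace PolyBounded

theorem mono {f g : α → ℕ} (hg : PolyBounded g) (h : ∀ a, f a ≤ g a) : PolyBounded f :=
  let ⟨p, hp⟩ := hg
  ⟨p, fun a => (h a).trans (hp a)⟩

theorem const (c : ℕ) : PolyBounded fun _ : α => c := ⟨Polynomial.C c, fun a => by simp⟩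

theorem add {f g : α → ℕ} (hf : PolyBounded f) (hg : PolyBounded g) :
    PolyBounded fun a => f a + g a :=
  let ⟨p, hp⟩ := hf
  let ⟨q, hq⟩ := hg
  ⟨p + q, fun a => by rw [Polynomial.eval_add]; exact add_le_add (hp a) (hq a)⟩

theorem mul {f g : α → ℕ} (hf : PolyBounded f) (hg : PolyBounded g) :
    PolyBounded fun a => f a * g a :=
  let ⟨p, hp⟩ := hf
  let ⟨q, hq⟩ := hg
  ⟨p * q, fun a => by rw [Polynomial.eval_mul]; exact Nat.mul_le_mul (hp a) (hq a)⟩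

/-- Each step is charged the size of its tree, so the cost of a run dominates the size of its
output. -/
theorem size {f : α → β} (hf : PolyTime f) : PolyBounded fun a => csize (f a) :=
  let ⟨_, p, h⟩ := hf
  ⟨p, fun a => let ⟨_, h₁, h₂⟩ := h a; h₁.size_le.trans h₂⟩

theorem length {f : α → List β} (hf : PolyTime f) : PolyBounded fun a => (f a).length :=
  (size hf).mono fun _ => (length_lt_csize _).le

theorem nat {f : α → ℕ} (hf : PolyTime f) : PolyBounded f :=
  (size hf).mono fun a => by rw [csize_nat]; omega

end PolyBounded

namespace PolyTime

theorem of_run {f : α → β} {P : Prog} {T : α → ℕ} (hT : PolyBounded T)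
    (h : ∀ a, ∃ t, Run P (code a) (code (f a)) t ∧ t ≤ T a) : PolyTime f :=
  let ⟨p, hp⟩ := hT
  ⟨P, p, fun a => let ⟨t, h₁, h₂⟩ := h a; ⟨t, h₁, h₂.trans (hp a)⟩⟩

theorem csize_bounded : PolyBounded fun a : α => csize a := ⟨.X, fun a => by simp⟩

/-- A map that does not change the tree. -/
theorem of_code_eq {f : α → β} (h : ∀ a, code (f a) = code a) : PolyTime f :=
  of_run csize_bounded fun a => ⟨_, by rw [h]; exact .skip _, le_rfl⟩

@[fun_prop]
theorem id : PolyTime fun a : α => a := of_code_eq fun _ => rfl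

-- The second program works on a tree no larger than the cost of the first, and polynomials over ℕ
-- are monotone, so the bounds compose.
@[fun_prop]
theorem comp {g : β → γ} {f : α → β} (hg : PolyTime g) (hf : PolyTime f) :
    PolyTime fun a => g (f a) := by
  obtain ⟨P, p, hP⟩ := hf
  obtain ⟨Q, q, hQ⟩ := hg
  refine ⟨.seq P Q, p + q.comp p + .X, fun a => ?_⟩
  obtain ⟨s, h₁, h₂⟩ := hP a
  obtain ⟨t, h₃, h₄⟩ := hQ (f a)
  refine ⟨_, .seq h₁ h₃, ?_⟩
  have := eval_mono q (h₁.size_le.trans h₂)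
  simp only [Polynomial.eval_add, Polynomial.eval_comp, Polynomial.eval_X]
  exact add_le_add (add_le_add h₂ (h₄.trans this)) le_rfl

@[fun_prop]
theorem pair {f : α → β} {g : α → γ} (hf : PolyTime f) (hg : PolyTime g) :
    PolyTime fun a => (f a, g a) := by
  obtain ⟨P, p, hP⟩ := hf
  obtain ⟨Q, q, hQ⟩ := hg
  refine ⟨.join P Q, p + q + .X, fun a => ?_⟩
  obtain ⟨s, h₁, h₂⟩ := hP a
  obtain ⟨t, h₃, h₄⟩ := hQ a
  refine ⟨_, .join h₁ h₃, ?_⟩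
  simp only [Polynomial.eval_add, Polynomial.eval_X]
  exact add_le_add (add_le_add h₂ h₄) le_rfl

@[fun_prop]
theorem fst' : PolyTime fun x : α × β => x.1 :=
  of_run csize_bounded fun _ => ⟨_, .left _, le_rfl⟩

@[fun_prop]
theorem snd' : PolyTime fun x : α × β => x.2 :=
  of_run csize_bounded fun _ => ⟨_, .right _, le_rfl⟩

@[fun_prop]
theorem fst {f : α → β × γ} (hf : PolyTime f) : PolyTime fun a => (f a).1 := fst'.comp hf

@[fun_prop]
theorem snd {f : α → β × γ} (hf : PolyTime f) : PolyTime fun a => (f a).2 := snd'.comp hf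

theorem exists_const (d : Data) : ∃ P c, ∀ x : Data, ∃ t, Run P x d t ∧ t ≤ c + c * x.size := by
  induction d with
  | nil => exact ⟨.nil, 1, fun x => ⟨_, .nil x, by omega⟩⟩
  | node l r hl hr =>
    obtain ⟨P, c, hP⟩ := hl
    obtain ⟨Q, d, hQ⟩ := hr
    refine ⟨.join P Q, c + d + 1, fun x => ?_⟩
    obtain ⟨s, h₁, h₂⟩ := hP x
    obtain ⟨t, h₃, h₄⟩ := hQ x
    exact ⟨_, .join h₁ h₃, by nlinarith⟩

@[fun_prop]
theorem const (b : β) : PolyTime fun _ : α => b := by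
  obtain ⟨P, c, h⟩ := exists_const (code b)
  exact of_run ((PolyBounded.const c).add ((PolyBounded.const c).mul csize_bounded)) fun a => h _

@[fun_prop]
theorem cond {c : α → Bool} {f g : α → β} (hc : PolyTime c) (hf : PolyTime f) (hg : PolyTime g) :
    PolyTime fun a => bif c a then f a else g a := by
  obtain ⟨C, r, hC⟩ := hc
  obtain ⟨P, p, hP⟩ := hf
  obtain ⟨Q, q, hQ⟩ := hg
  refine ⟨.ite C P Q, r + p + q + .X, fun a => ?_⟩
  obtain ⟨s, h₁, h₂⟩ := hC a
  obtain ⟨t, h₃, h₄⟩ := hP a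
  obtain ⟨u, h₅, h₆⟩ := hQ a
  simp only [Polynomial.eval_add, Polynomial.eval_X]
  cases h : c a <;> rw [h] at h₁
  · refine ⟨_, .ite_false h₁ h₅, ?_⟩
    change s + u + csize a ≤ _
    omega
  · refine ⟨_, .ite_true h₁ h₃, ?_⟩
    change s + t + csize a ≤ _
    omega

/-- The loop state is the triple of parameter, remaining list and accumulator. A non-empty list is
coded by a node, so its own code serves as the loop test; the body removes the head and hands it to
`P`. -/
theorem run_fold {f : α → σ → β → σ} {P : Prog} {p : Polynomial ℕ}
    (hP : ∀ x : (α × σ) × β, ∃ t, Run P (code x) (code (f x.1.1 x.1.2 x.2)) t ∧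
      t ≤ p.eval (csize x)) (a : α) (M : ℕ) (l : List β) (s : σ)
    (hM : ∀ l₁ l₂, l = l₁ ++ l₂ → csize (a, l₂, l₁.foldl (f a) s) ≤ M) :
    ∃ t, Run (.loop (.seq .right .left) (.join .left (.join (.seq .right (.seq .left .right))
        (.seq (.join (.join .left (.seq .right .right)) (.seq .right (.seq .left .left))) P))))
      (code (a, l, s)) (code (a, ([] : List β), l.foldl (f a) s)) t ∧
      t ≤ (l.length + 1) * (30 * M + p.eval M) := by
  induction l generalizing s with
  | nil =>
    refine ⟨_, .loop_done (.seq (.right _) (.left _)), ?_⟩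
    have h₀ := hM [] [] rfl
    simp only [csize_pair, List.foldl_nil, csize_nil] at h₀
    change csize (a, [], s) + csize (([] : List β), s) + csize (a, [], s) + csize (a, [], s) ≤ _
    simp only [csize_pair, List.length_nil, csize_nil, zero_add, one_mul]
    omega
  | cons b l ih =>
    obtain ⟨t, h₁, h₂⟩ := ih (f a s b) fun l₁ l₂ h => hM (b :: l₁) l₂ (by simp [h])
    obtain ⟨u, h₃, h₄⟩ := hP ((a, s), b)
    refine ⟨_, .loop_step (.seq (.right _) (.left _)) (.join (.left _) (.join (.seq (.right _)
      (.seq (.left _) (.right _))) (.seq (.join (.join (.left _) (.seq (.right _) (.right _)))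
      (.seq (.right _) (.seq (.left _) (.left _)))) h₃))) h₁, ?_⟩
    have h₀ := hM [] (b :: l) rfl
    simp only [csize_pair, List.foldl_nil, csize_cons] at h₀
    have h₅ : u ≤ p.eval M := h₄.trans (eval_mono p (by simp only [csize_pair]; omega))
    let X := csize (a, b :: l, s)
    let Y := csize (b :: l, s)
    let Z := csize (b :: l)
    -- The charges of one pass other than `u` and `t`: fewer than 30, each at most `M`.
    change (X + Y + X) + (X + ((X + (Y + Z + Y) + X) +
      ((X + (X + Y + X) + X) + (X + (Y + Z + Y) + X) + X + u + X) + X) + X) + t + X ≤ _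
    have hX : X ≤ M := by simp only [X, csize_pair, csize_cons]; omega
    have hY : Y ≤ M := by simp only [Y, csize_pair, csize_cons]; omega
    have hZ : Z ≤ M := by simp only [Z, csize_cons]; omega
    rw [List.length_cons, Nat.succ_mul (l.length + 1)]
    omega

/-- Iterating a polynomial-time step may blow up the accumulator, so a polynomial bound `B` is
required after every prefix of the list. -/
theorem foldl {l : α → List β} {i : α → σ} {f : α → σ → β → σ} (hl : PolyTime l)
    (hi : PolyTime i) (hf : PolyTime fun x : (α × σ) × β => f x.1.1 x.1.2 x.2) {B : α → ℕ}
    (hB : PolyBounded B)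
    (h : ∀ a l₁ l₂, l a = l₁ ++ l₂ → csize (l₁.foldl (f a) (i a)) ≤ B a) :
    PolyTime fun a => (l a).foldl (f a) (i a) := by
  obtain ⟨P, p, hP⟩ := hf
  obtain ⟨L, pl, hL⟩ := id (α := α) |>.pair (hl.pair hi)
  obtain ⟨pB, hB⟩ := hB
  let M : Polynomial ℕ := 2 * pl + pB
  refine ⟨.seq L (.seq (.loop (.seq .right .left) (.join .left (.join (.seq .right
    (.seq .left .right)) (.seq (.join (.join .left (.seq .right .right))
    (.seq .right (.seq .left .left))) P)))) (.seq .right .right)),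
    pl + (M * (30 * M + p.comp M) + 3 * M + M) + .X, fun a => ?_⟩
  obtain ⟨s, h₁, h₂⟩ := hL a
  have h₃ := h₁.size_le.trans h₂
  change csize (a, l a, i a) ≤ _ at h₃
  have hM : M.eval (csize a) = 2 * pl.eval (csize a) + pB.eval (csize a) := by simp [M]
  have hlen := length_lt_csize (l a)
  have hl' : csize (l a) + csize a + 3 ≤ pl.eval (csize a) := by
    simp only [csize_pair] at h₃; have := one_le_csize (i a); omega
  have hbd : ∀ l₁ l₂, l a = l₁ ++ l₂ →
      csize (a, l₂, l₁.foldl (f a) (i a)) ≤ M.eval (csize a) := by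
    intro l₁ l₂ e
    have e₁ := (h a l₁ l₂ e).trans (hB a)
    have e₂ := csize_append l₁ l₂
    have := one_le_csize l₁
    rw [← e] at e₂
    simp only [csize_pair]
    omega
  obtain ⟨t, h₄, h₅⟩ := run_fold hP a _ (l a) (i a) hbd
  refine ⟨_, .seq h₁ (.seq h₄ (.seq (.right _) (.right _))), ?_⟩
  let X := csize (a, ([] : List β), (l a).foldl (f a) (i a))
  let Y := csize (([] : List β), (l a).foldl (f a) (i a))
  have hX : X ≤ M.eval (csize a) := hbd (l a) [] (by simp)
  have hY : Y ≤ X := by simp only [X, csize_pair _ (_, _)]; omega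
  change s + (t + (X + Y + X) + csize (a, l a, i a)) + csize a ≤ _
  simp only [Polynomial.eval_add, Polynomial.eval_mul, Polynomial.eval_comp, Polynomial.eval_X,
    Polynomial.eval_ofNat]
  have : t ≤ M.eval (csize a) * (30 * M.eval (csize a) + p.eval (M.eval (csize a))) :=
    h₅.trans (Nat.mul_le_mul_right _ (by omega))
  omega

end PolyTime

end

/-! ### Polynomial-time operations on numbers, truth values and lists. -/

section

variable {α β γ σ : Type} [Coded α] [Coded β] [Coded γ] [Coded σ]

namespace PolyBounded

theorem eval (p : Polynomial ℕ) {g : α → ℕ} (hg : PolyBounded g) :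
    PolyBounded fun a => p.eval (g a) :=
  let ⟨q, hq⟩ := hg
  ⟨p.comp q, fun a => by rw [Polynomial.eval_comp]; exact eval_mono _ (hq a)⟩

end PolyBounded

namespace PolyTime

@[fun_prop]
theorem cons {f : α → β} {g : α → List β} (hf : PolyTime f) (hg : PolyTime g) :
    PolyTime fun a => f a :: g a :=
  (of_code_eq (f := fun x : β × List β => x.1 :: x.2) fun _ => rfl).comp (hf.pair hg)

@[fun_prop]
theorem tail {f : α → List β} (hf : PolyTime f) : PolyTime fun a => (f a).tail :=
  comp (g := List.tail) (of_run csize_bounded fun l =>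
    ⟨csize l, by convert Run.right (code l) using 1; exacts [by cases l <;> rfl, rfl], le_rfl⟩) hf

@[fun_prop]
theorem isEmpty {f : α → List β} (hf : PolyTime f) : PolyTime fun a => (f a).isEmpty :=
  comp (g := List.isEmpty) (of_run (P := .ite .skip .nil (.join .nil .nil))
    ((PolyBounded.const 5).mul csize_bounded) fun l => by
      cases l with
      | nil => exact ⟨_, .ite_false (.skip _) (.join (.nil _) (.nil _)),
          show 1 + (1 + 1 + 1) + 1 ≤ 5 * 1 by decide⟩
      | cons b l =>
        refine ⟨_, .ite_true (.skip _) (.nil _), ?_⟩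
        change csize (b :: l) + csize (b :: l) + csize (b :: l) ≤ _
        omega) hf

@[fun_prop]
theorem headD {f : α → List β} (hf : PolyTime f) (d : β) : PolyTime fun a => (f a).headD d := by
  obtain ⟨P, c, hP⟩ := exists_const (code d)
  refine comp (g := fun l : List β => l.headD d) (of_run (P := .ite .skip .left P)
    ((PolyBounded.const c).add ((PolyBounded.const (c + 5)).mul csize_bounded)) fun l => ?_) hf
  cases l with
  | nil =>
    obtain ⟨t, h₁, h₂⟩ := hP .nil
    refine ⟨_, .ite_false (.skip _) h₁, ?_⟩
    change 1 + t + 1 ≤ c + (c + 5) * 1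
    change t ≤ c + c * 1 at h₂
    omega
  | cons b l =>
    refine ⟨_, .ite_true (.skip _) (.left _), ?_⟩
    change csize (b :: l) + csize (b :: l) + csize (b :: l) ≤ _
    nlinarith

-- A unary number and a list of as many units are the same tree, which turns loops over numbers into
-- folds.
@[fun_prop]
theorem units {f : α → ℕ} (hf : PolyTime f) : PolyTime fun a => List.replicate (f a) () :=
  comp (g := fun n => List.replicate n ()) (of_code_eq fun n => by
    induction n with
    | zero => rfl
    | succ n ih => exact congrArg (Data.node .nil) ih) hf

theorem succ {f : α → ℕ} (hf : PolyTime f) : PolyTime fun a => f a + 1 :=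
  comp (g := fun n => n + 1) (of_run (P := .join .nil .skip)
    ((PolyBounded.const 3).mul csize_bounded) fun n =>
      ⟨_, .join (.nil _) (.skip _), by change csize n + csize n + csize n ≤ _; omega⟩) hf

theorem pred {f : α → ℕ} (hf : PolyTime f) : PolyTime fun a => f a - 1 :=
  comp (g := fun n => n - 1) (of_run csize_bounded fun n =>
    ⟨csize n, by convert Run.right (code n) using 1; exacts [by cases n <;> rfl, rfl], le_rfl⟩) hf

@[fun_prop]
theorem add {f g : α → ℕ} (hf : PolyTime f) (hg : PolyTime g) : PolyTime fun a => f a + g a := by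
  have key : ∀ l : List Unit, ∀ s : ℕ, l.foldl (fun s _ => s + 1) s = s + l.length := by
    intro l
    induction l with
    | nil => simp
    | cons _ l ih => intro s; rw [List.foldl_cons, ih, List.length_cons]; omega
  have := foldl (f := fun (_ : α) (s : ℕ) (_ : Unit) => s + 1) hg.units hf (succ (by fun_prop))
    (B := fun a => 2 * (f a + g a) + 1)
    (((PolyBounded.const 2).mul (.add (.nat hf) (.nat hg))).add (.const 1)) (fun a l₁ l₂ h => by
      have := congrArg List.length h
      simp only [List.length_replicate, List.length_append] at this
      rw [key, csize_nat]; omega)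
  simpa [key] using this

@[fun_prop]
theorem sub {f g : α → ℕ} (hf : PolyTime f) (hg : PolyTime g) : PolyTime fun a => f a - g a := by
  have key : ∀ l : List Unit, ∀ s : ℕ, l.foldl (fun s _ => s - 1) s = s - l.length := by
    intro l
    induction l with
    | nil => simp
    | cons _ l ih => intro s; rw [List.foldl_cons, ih, List.length_cons]; omega
  have := foldl (f := fun (_ : α) (s : ℕ) (_ : Unit) => s - 1) hg.units hf (pred (by fun_prop))
    (B := fun a => csize (f a)) (.size hf) (fun a l₁ l₂ h => by
      rw [key, csize_nat, csize_nat]; omega)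
  simpa [key] using this

@[fun_prop]
theorem not {f : α → Bool} (hf : PolyTime f) : PolyTime fun a => !(f a) := by
  have := cond hf (const false) (const true)
  convert this using 2 with a
  cases f a <;> rfl

@[fun_prop]
theorem and {f g : α → Bool} (hf : PolyTime f) (hg : PolyTime g) :
    PolyTime fun a => f a && g a := by
  have := cond hf hg (const false)
  convert this using 2 with a
  cases f a <;> rfl

@[fun_prop]
theorem or {f g : α → Bool} (hf : PolyTime f) (hg : PolyTime g) :
    PolyTime fun a => f a || g a := by
  have := cond hf (const true) hg
  convert this using 2 with a
  cases f a <;> rfl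

@[fun_prop]
theorem bne {f g : α → Bool} (hf : PolyTime f) (hg : PolyTime g) :
    PolyTime fun a => f a != g a := by
  have := cond hf (not hg) hg
  convert this using 2 with a
  cases f a <;> cases g a <;> rfl

@[fun_prop]
theorem le {f g : α → ℕ} (hf : PolyTime f) (hg : PolyTime g) :
    PolyTime fun a => decide (f a ≤ g a) := by
  have := isEmpty (units (sub hf hg))
  convert this using 2 with a
  rw [Bool.eq_iff_iff]
  simp [Nat.sub_eq_zero_iff_le]

@[fun_prop]
theorem eq {f g : α → ℕ} (hf : PolyTime f) (hg : PolyTime g) :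
    PolyTime fun a => decide (f a = g a) := by
  have := and (le hf hg) (le hg hf)
  convert this using 2 with a
  rw [Bool.eq_iff_iff]
  simp [le_antisymm_iff]

@[fun_prop]
theorem drop {f : α → List β} {g : α → ℕ} (hf : PolyTime f) (hg : PolyTime g) :
    PolyTime fun a => (f a).drop (g a) := by
  have key : ∀ l : List Unit, ∀ s : List β, l.foldl (fun s _ => s.tail) s = s.drop l.length := by
    intro l
    induction l with
    | nil => simp
    | cons _ l ih => intro s; rw [List.foldl_cons, ih, List.length_cons]; simp
  have := foldl (f := fun (_ : α) (s : List β) (_ : Unit) => s.tail) hg.units hf (by fun_prop)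
    (B := fun a => csize (f a)) (.size hf) (fun a l₁ l₂ h => by
      rw [key]; exact csize_sublist (List.drop_sublist _ _))
  simpa [key] using this

@[fun_prop]
theorem getD {f : α → List β} {g : α → ℕ} (hf : PolyTime f) (hg : PolyTime g) (d : β) :
    PolyTime fun a => (f a).getD (g a) d := by
  have := headD (drop hf hg) d
  convert this using 2 with a
  simp [List.headD_eq_head?_getD, List.head?_drop, List.getD_eq_getElem?_getD]

@[fun_prop]
theorem reverse {f : α → List β} (hf : PolyTime f) : PolyTime fun a => (f a).reverse := by
  have key : ∀ l s : List β, l.foldl (fun s b => b :: s) s = l.reverse ++ s := by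
    intro l
    induction l with
    | nil => simp
    | cons _ l ih => intro s; rw [List.foldl_cons, ih]; simp
  have := foldl (f := fun (_ : α) (s : List β) b => b :: s) hf (const []) (by fun_prop)
    (B := fun a => csize (f a)) (.size hf) (fun a l₁ l₂ h => by
      rw [key, List.append_nil, csize_reverse, h]
      exact csize_sublist (List.sublist_append_left _ _))
  simpa [key] using this

@[fun_prop]
theorem append {f g : α → List β} (hf : PolyTime f) (hg : PolyTime g) :
    PolyTime fun a => f a ++ g a := by
  have key : ∀ l s : List β, l.foldl (fun s b => b :: s) s = l.reverse ++ s := by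
    intro l
    induction l with
    | nil => simp
    | cons _ l ih => intro s; rw [List.foldl_cons, ih]; simp
  have := foldl (f := fun (_ : α) (s : List β) b => b :: s) hf.reverse hg (by fun_prop)
    (B := fun a => csize (f a) + csize (g a)) (.add (.size hf) (.size hg)) (fun a l₁ l₂ h => by
      have e₁ := csize_append l₁ l₂
      have e₂ := csize_append l₁.reverse (g a)
      have e₃ := one_le_csize l₂
      rw [← h] at e₁
      rw [csize_reverse] at e₁ e₂
      rw [key]; omega)
  simpa [key] using this

@[fun_prop]
theorem length {f : α → List β} (hf : PolyTime f) : PolyTime fun a => (f a).length := by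
  have key : ∀ l : List β, ∀ s : ℕ, l.foldl (fun s _ => s + 1) s = s + l.length := by
    intro l
    induction l with
    | nil => simp
    | cons _ l ih => intro s; rw [List.foldl_cons, ih, List.length_cons]; omega
  have := foldl (f := fun (_ : α) (s : ℕ) (_ : β) => s + 1) hf (const 0) (by fun_prop)
    (B := fun a => 2 * csize (f a)) ((PolyBounded.const 2).mul (.size hf)) (fun a l₁ l₂ h => by
      have := length_lt_csize (f a)
      rw [h] at this ⊢
      simp only [List.length_append] at this
      rw [key, csize_nat]; omega)
  simpa [key] using this

theorem csize_flatMap_le {δ : Type} {l : List δ} {f : δ → List γ} {M : ℕ} (h : ∀ b ∈ l, csize (f b) ≤ M) :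
    csize (l.flatMap f) ≤ l.length * M + 1 := by
  induction l with
  | nil => simp
  | cons b l ih =>
    have h₁ := csize_append (f b) (l.flatMap f)
    have h₂ := ih fun c hc => h c (by simp [hc])
    have h₃ := h b (by simp)
    rw [List.flatMap_cons, List.length_cons, Nat.succ_mul]
    omega

/-- The accumulator stays below the number of elements times a bound for one block; `map`, `filter`,
`countP`, `all` and `any` all reduce to this case. -/
theorem flatMap {l : α → List β} {f : α → β → List γ} (hl : PolyTime l)
    (hf : PolyTime fun x : α × β => f x.1 x.2) : PolyTime fun a => (l a).flatMap (f a) := by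
  have key : ∀ a, ∀ l : List β, ∀ s : List γ,
      l.foldl (fun s b => s ++ f a b) s = s ++ l.flatMap (f a) := by
    intro a l
    induction l with
    | nil => simp
    | cons _ l ih => intro s; rw [List.foldl_cons, ih]; simp
  obtain ⟨p, hp⟩ := PolyBounded.size hf
  have := foldl (f := fun (a : α) (s : List γ) b => s ++ f a b) hl (const [])
    (append (by fun_prop) (hf.comp (f := fun x : (α × List γ) × β => (x.1.1, x.2)) (by fun_prop)))
    (B := fun a => (l a).length * p.eval (csize a + csize (l a) + 1) + 1)
    (.add (.mul (.length hl) (.eval p (.add (.add csize_bounded (.size hl)) (.const 1))))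
      (.const 1)) (fun a l₁ l₂ h => by
      rw [key, List.nil_append]
      refine (csize_flatMap_le (M := p.eval (csize a + csize (l a) + 1)) fun b hb => ?_).trans ?_
      · refine (hp (a, b)).trans (eval_mono _ ?_)
        have : b ∈ l a := by rw [h]; simp [hb]
        have := csize_mem this
        rw [csize_pair]; omega
      · have : l₁.length ≤ (l a).length := by rw [h]; simp
        gcongr)
  simpa [key] using this

theorem map {l : α → List β} {f : α → β → γ} (hl : PolyTime l)
    (hf : PolyTime fun x : α × β => f x.1 x.2) : PolyTime fun a => (l a).map (f a) := by
  have := flatMap (f := fun a b => [f a b]) hl (by fun_prop)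
  convert this using 2
  exact List.map_eq_flatMap

theorem filter {l : α → List β} {f : α → β → Bool} (hl : PolyTime l)
    (hf : PolyTime fun x : α × β => f x.1 x.2) : PolyTime fun a => (l a).filter (f a) := by
  have := flatMap (f := fun a b => bif f a b then [b] else []) hl (by fun_prop)
  convert this using 2 with a
  induction l a with
  | nil => rfl
  | cons b l ih => cases h : f a b <;> simp [h, ih]

theorem countP {l : α → List β} {f : α → β → Bool} (hl : PolyTime l)
    (hf : PolyTime fun x : α × β => f x.1 x.2) : PolyTime fun a => (l a).countP (f a) := by
  simpa only [List.countP_eq_length_filter] using length (filter hl hf)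

theorem all {l : α → List β} {f : α → β → Bool} (hl : PolyTime l)
    (hf : PolyTime fun x : α × β => f x.1 x.2) : PolyTime fun a => (l a).all (f a) := by
  have := isEmpty (filter (f := fun a b => !(f a b)) hl (by fun_prop))
  convert this using 2 with a
  rw [Bool.eq_iff_iff]
  simp

theorem any {l : α → List β} {f : α → β → Bool} (hl : PolyTime l)
    (hf : PolyTime fun x : α × β => f x.1 x.2) : PolyTime fun a => (l a).any (f a) := by
  have := not (isEmpty (filter (f := f) hl (by fun_prop)))
  convert this using 2 with a
  rw [Bool.eq_iff_iff]
  simp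

@[fun_prop]
theorem range {f : α → ℕ} (hf : PolyTime f) : PolyTime fun a => List.range (f a) := by
  have key : ∀ l : List Unit,
      l.foldl (fun s _ => s ++ [s.length]) ([] : List ℕ) = List.range l.length := by
    intro l
    induction l using List.reverseRecOn with
    | nil => rfl
    | append_singleton l a ih =>
      rw [List.foldl_append, ih, List.length_append, List.length_singleton, List.range_succ]
      simp
  have := foldl (f := fun (_ : α) (s : List ℕ) (_ : Unit) => s ++ [s.length]) hf.units
    (const ([] : List ℕ)) (by fun_prop) (B := fun a => f a * (csize (f a) + 1) + 1)
    (.add (.mul (.nat hf) (.add (.size hf) (.const 1))) (.const 1)) (fun a l₁ l₂ h => by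
      have := congrArg List.length h
      simp only [List.length_replicate, List.length_append] at this
      rw [key]
      refine csize_list_le (by rw [List.length_range]; omega) fun i hi => ?_
      rw [List.mem_range] at hi
      rw [csize_nat, csize_nat]; omega)
  simpa [key] using this

end PolyTime

end

/-! ### The algorithm: greedy tree packing, fundamental cuts, filtering. -/

/-- An edge given by its load and its two ends. -/
abbrev LoadedEdge : Type := ℕ × ℕ × ℕ

/-- The two ends of the edge have the same label. -/
def joined (labs : List ℕ) (e : LoadedEdge) : Bool :=
  decide (labs.getD e.2.1 0 = labs.getD e.2.2 0)

/-- Merge the classes of the two ends of an edge. -/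
def link (labs : List ℕ) (e : LoadedEdge) : List ℕ :=
  labs.map fun x => bif decide (x = labs.getD e.2.2 0) then labs.getD e.2.1 0 else x

/-- One step of Kruskal's algorithm; the state consists of the labels, the edges met so far with
their new loads, and the edges of the forest. -/
def kruskalStep (st : List ℕ × List LoadedEdge × List LoadedEdge) (e : LoadedEdge) :
    List ℕ × List LoadedEdge × List LoadedEdge :=
  bif joined st.1 e then (st.1, e :: st.2.1, st.2.2)
  else (link st.1 e, (e.1 + 1, e.2) :: st.2.1, e :: st.2.2)

/-- Kruskal's algorithm, raising the load of each edge of the forest by one. -/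
def kruskal (n : ℕ) (es : List LoadedEdge) : List ℕ × List LoadedEdge × List LoadedEdge :=
  es.foldl kruskalStep (List.range n, [], [])

/-- Insertion of an edge into a list sorted by load. -/
def insertByLoad (l : List LoadedEdge) (e : LoadedEdge) : List LoadedEdge :=
  l.filter (fun f => decide (f.1 ≤ e.1)) ++ e :: l.filter fun f => !decide (f.1 ≤ e.1)

/-- Sorting by load. -/
def sortByLoad (es : List LoadedEdge) : List LoadedEdge := es.foldl insertByLoad []

/-- One round of greedy tree packing; the state consists of the loaded edges and the forests. -/
def packStep (n : ℕ) (st : List LoadedEdge × List (List LoadedEdge)) :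
    List LoadedEdge × List (List LoadedEdge) :=
  (sortByLoad (kruskal n st.1).2.1, (kruskal n st.1).2.2 :: st.2)

/-- Greedy tree packing, with one round for each element of a list. -/
def packing (n : ℕ) (es : List LoadedEdge) (rounds : List Unit) :
    List LoadedEdge × List (List LoadedEdge) :=
  rounds.foldl (fun st _ => packStep n st) (es, [])

/-- The labels of the components of a graph. -/
def components (n : ℕ) (es : List LoadedEdge) : List ℕ := es.foldl link (List.range n)

/-- The fundamental cuts of a forest. -/
def fundamentalCuts (n : ℕ) (T : List LoadedEdge) : List (List Bool) :=
  (List.range T.length).map fun i =>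
    (components n (T.take i ++ T.drop (i + 1))).map fun x =>
      decide (x = (components n (T.take i ++ T.drop (i + 1))).getD (T.getD i (0, 0, 0)).2.1 0)

/-- The symmetric difference. -/
def xorBits (n : ℕ) (A B : List Bool) : List Bool :=
  (List.range n).map fun i => A.getD i false != B.getD i false

/-- Add the symmetric differences with the sets of a list. -/
def extendBy (n : ℕ) (X C : List (List Bool)) : List (List Bool) :=
  C.flatMap fun A => A :: X.map fun B => xorBits n A B

/-- The symmetric differences of at most `r` sets of a list, and their complements. -/
def sums (n : ℕ) (X : List (List Bool)) : ℕ → List (List Bool)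
  | 0 => [(List.range n).map fun _ => false, (List.range n).map fun _ => true]
  | r + 1 => extendBy n X (sums n X r)

/-- Edges with their ends and the bit of the not-safe ones. -/
abbrev FlaggedEdge : Type := ℕ × ℕ × Bool

/-- A list of sets that includes all cuts of minimum or almost minimum size. -/
def candidates (n k : ℕ) (es : List FlaggedEdge) : List (List Bool) :=
  sums n ((packing n (es.map fun e => (0, e.1, e.2.1))
    (es.flatMap fun _ => List.replicate k ())).2.flatMap (fundamentalCuts n)) 8

/-- The edge has exactly one end in the set. -/
def crosses (A : List Bool) (e : FlaggedEdge) : Bool := A.getD e.1 false != A.getD e.2.1 false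

/-- Membership in the family of tight cuts. -/
def isTight (k : ℕ) (es : List FlaggedEdge) (A : List Bool) : Bool :=
  A.any (fun b => b) && A.any (fun b => !b) && decide (es.countP (crosses A) = k + 1) &&
    decide (2 ≤ es.countP fun e => crosses A e && e.2.2)

/-- The two sets cross. -/
def crossing (n : ℕ) (A B : List Bool) : Bool :=
  (List.range n).any (fun i => A.getD i false && B.getD i false) &&
  (List.range n).any (fun i => A.getD i false && !(B.getD i false)) &&
  (List.range n).any (fun i => B.getD i false && !(A.getD i false)) &&
  (List.range n).any (fun i => !(A.getD i false) && !(B.getD i false))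

/-- The first set has a red side edge in the quotient graph. -/
def redSide (es : List FlaggedEdge) (A B : List Bool) : Bool :=
  decide (2 ≤ es.countP fun e => e.2.2 && (crosses A e &&
    (B.getD e.1 false && B.getD e.2.1 false))) ||
  decide (2 ≤ es.countP fun e => e.2.2 && (crosses A e &&
    (!(B.getD e.1 false) && !(B.getD e.2.1 false))))

/-- The list of the tight cuts. -/
def tightList (n k : ℕ) (es : List FlaggedEdge) : List (List Bool) :=
  (candidates n k es).filter (isTight k es)

/-- The tight cuts having a red side edge with each tight cut that crosses them. -/
def redList (n k : ℕ) (es : List FlaggedEdge) : List (List Bool) :=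
  (tightList n k es).filter fun A =>
    (tightList n k es).all fun B => !(crossing n A B) || redSide es A B

/-- The tight cuts with two not-safe edges having no red side edge with any tight cut that
crosses them. -/
def blueList (n k : ℕ) (es : List FlaggedEdge) : List (List Bool) :=
  (tightList n k es).filter fun A =>
    decide ((es.countP fun e => crosses A e && e.2.2) = 2) &&
      (tightList n k es).all fun B => !(crossing n A B) || !(redSide es A B)

/-! ### Running time of the algorithm. -/

section

variable {α β : Type} [Coded α] [Coded β]

namespace PolyTime

@[fun_prop]
theorem take {f : α → List β} {g : α → ℕ} (hf : PolyTime f) (hg : PolyTime g) :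
    PolyTime fun a => (f a).take (g a) := by
  have : PolyTime fun a => ((f a).reverse.drop ((f a).length - g a)).reverse := by fun_prop
  convert this using 2 with a
  rw [List.drop_reverse, List.reverse_reverse]
  rcases le_total (g a) (f a).length with h | h
  · rw [Nat.sub_sub_self h]
  · rw [Nat.sub_eq_zero_of_le h, Nat.sub_zero, List.take_of_length_le h, List.take_length]

@[fun_prop]
theorem joined {f : α → List ℕ} {g : α → LoadedEdge} (hf : PolyTime f) (hg : PolyTime g) :
    PolyTime fun a => joined (f a) (g a) := by
  unfold FlexCut.joined; fun_prop

@[fun_prop]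
theorem link {f : α → List ℕ} {g : α → LoadedEdge} (hf : PolyTime f) (hg : PolyTime g) :
    PolyTime fun a => link (f a) (g a) :=
  map hf (by fun_prop)

/-- Merging only copies existing labels (or the default 0), so the label list keeps quadratic size.
-/
theorem link_bound {n : ℕ} {labs : List ℕ} (h : labs.length = n ∧ ∀ x ∈ labs, x ≤ n)
    (e : LoadedEdge) : (FlexCut.link labs e).length = n ∧ ∀ x ∈ FlexCut.link labs e, x ≤ n := by
  refine ⟨by simp [FlexCut.link, h.1], fun x hx => ?_⟩
  obtain ⟨y, hy, rfl⟩ := List.mem_map.1 hx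
  cases hd : decide (y = labs.getD e.2.2 0)
  · exact h.2 y hy
  · show labs.getD e.2.1 0 ≤ n
    rcases lt_or_ge e.2.1 labs.length with h' | h'
    · rw [List.getD_eq_getElem _ _ h']; exact h.2 _ (List.getElem_mem h')
    · rw [List.getD_eq_default _ _ h']; exact Nat.zero_le _

theorem range_bound (n : ℕ) : (List.range n).length = n ∧ ∀ x ∈ List.range n, x ≤ n :=
  ⟨List.length_range, fun _ hx => (List.mem_range.1 hx).le⟩

theorem csize_labels {n : ℕ} {labs : List ℕ} (h : labs.length = n ∧ ∀ x ∈ labs, x ≤ n) :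
    csize labs ≤ n * (2 * n + 2) + 1 :=
  csize_list_le h.1.le fun x hx => by rw [csize_nat]; have := h.2 x hx; omega

theorem kruskalStep {f : α → List ℕ × List LoadedEdge × List LoadedEdge} {g : α → LoadedEdge}
    (hf : PolyTime f) (hg : PolyTime g) : PolyTime fun a => kruskalStep (f a) (g a) := by
  unfold FlexCut.kruskalStep; fun_prop

/-- A load grows by at most one, which adds two nodes to its unary code. -/
theorem kruskal_bound (n : ℕ) (l : List LoadedEdge) :
    ((kruskal n l).1.length = n ∧ ∀ x ∈ (kruskal n l).1, x ≤ n) ∧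
      csize (kruskal n l).2.1 ≤ csize l + 2 * l.length ∧
      csize (kruskal n l).2.2 ≤ csize l := by
  induction l using List.reverseRecOn with
  | nil => exact ⟨range_bound n, Nat.le_add_right _ _, le_rfl⟩
  | append_singleton l e ih =>
    have h : kruskal n (l ++ [e]) = FlexCut.kruskalStep (kruskal n l) e := by
      simp [kruskal, List.foldl_append]
    have hc := csize_append l [e]
    rw [csize_cons, csize_nil] at hc
    rw [h, FlexCut.kruskalStep, List.length_append, List.length_singleton]
    have he : csize ((e.1 + 1, e.2) : LoadedEdge) = csize e + 2 := by
      obtain ⟨w, e⟩ := e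
      simp only [csize_pair, csize_nat]; omega
    cases FlexCut.joined (kruskal n l).1 e
    · refine ⟨link_bound ih.1 e, ?_, ?_⟩ <;> simp only [cond_false, csize_cons] <;> omega
    · refine ⟨ih.1, ?_, ?_⟩ <;> simp only [cond_true, csize_cons] <;> omega

@[fun_prop]
theorem kruskal {f : α → ℕ} {g : α → List LoadedEdge} (hf : PolyTime f) (hg : PolyTime g) :
    PolyTime fun a => kruskal (f a) (g a) :=
  foldl (f := fun _ st e => FlexCut.kruskalStep st e) hg (by fun_prop)
    (kruskalStep (by fun_prop) (by fun_prop))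
    (B := fun a => (f a * (2 * f a + 2) + 1) + 4 * csize (g a) + 2)
    (.add (.add (.add (.mul (.nat hf) (.add (.mul (.const 2) (.nat hf)) (.const 2))) (.const 1))
      (.mul (.const 4) (.size hg))) (.const 2)) (fun a l₁ l₂ h => by
        obtain ⟨h₁, h₂, h₃⟩ := kruskal_bound (f a) l₁
        have h₄ := csize_labels h₁
        have h₅ := length_lt_csize l₁
        have h₆ := csize_append l₁ l₂
        have h₇ := one_le_csize l₂
        rw [← h] at h₆
        change csize (FlexCut.kruskal (f a) l₁) ≤ _
        have h₈ : csize (FlexCut.kruskal (f a) l₁) = csize (FlexCut.kruskal (f a) l₁).1 +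
          (csize (FlexCut.kruskal (f a) l₁).2.1 + csize (FlexCut.kruskal (f a) l₁).2.2 + 1) + 1 := rfl
        omega)

theorem insertByLoad {f : α → List LoadedEdge} {g : α → LoadedEdge} (hf : PolyTime f)
    (hg : PolyTime g) : PolyTime fun a => insertByLoad (f a) (g a) :=
  append (filter hf (by fun_prop)) (cons hg (filter hf (by fun_prop)))

end PolyTime

theorem insertByLoad_perm (l : List LoadedEdge) (e : LoadedEdge) :
    (insertByLoad l e).Perm (e :: l) :=
  List.perm_middle.trans (.cons _ (List.filter_append_perm _ _))

theorem sortByLoad_perm (es : List LoadedEdge) : (sortByLoad es).Perm es := by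
  induction es using List.reverseRecOn with
  | nil => exact .refl _
  | append_singleton l e ih =>
    rw [sortByLoad, List.foldl_append]
    exact (insertByLoad_perm _ e).trans ((ih.cons e).trans (List.perm_append_singleton e l).symm)

namespace PolyTime

@[fun_prop]
theorem sortByLoad {g : α → List LoadedEdge} (hg : PolyTime g) :
    PolyTime fun a => sortByLoad (g a) :=
  foldl (f := fun _ st e => FlexCut.insertByLoad st e) hg (by fun_prop)
    (insertByLoad (by fun_prop) (by fun_prop)) (B := fun a => csize (g a)) (.size hg)
    (fun a l₁ l₂ h => by
      change csize (FlexCut.sortByLoad l₁) ≤ _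
      rw [csize_perm (sortByLoad_perm l₁), h]
      exact csize_sublist (List.sublist_append_left _ _))

@[fun_prop]
theorem packStep {f : α → ℕ} {g : α → List LoadedEdge × List (List LoadedEdge)}
    (hf : PolyTime f) (hg : PolyTime g) : PolyTime fun a => packStep (f a) (g a) := by
  unfold FlexCut.packStep; fun_prop

end PolyTime

theorem kruskal_length (n : ℕ) (l : List LoadedEdge) :
    (kruskal n l).2.1.length = l.length := by
  induction l using List.reverseRecOn with
  | nil => rfl
  | append_singleton l e ih =>
    have h : kruskal n (l ++ [e]) = kruskalStep (kruskal n l) e := by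
      simp [kruskal, List.foldl_append]
    rw [h, kruskalStep]
    cases joined (kruskal n l).1 e <;> simp [ih]

namespace PolyTime

/-- Loads grow by at most one per round, so the edge list grows only linearly in the number of
rounds, and each stored forest is no larger than the edge list it comes from. -/
theorem packing_bound (n : ℕ) (es : List LoadedEdge) (l : List Unit) :
    (packing n es l).1.length = es.length ∧
      csize (packing n es l).1 ≤ csize es + 2 * es.length * l.length ∧
      csize (packing n es l).2 ≤ l.length * (csize es + 2 * es.length * l.length + 1) + 1 := by
  induction l using List.reverseRecOn with
  | nil => simp [packing]
  | append_singleton l u ih =>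
    have h : packing n es (l ++ [u]) = FlexCut.packStep n (packing n es l) := by
      simp [packing, List.foldl_append]
    obtain ⟨h₁, h₂, h₃⟩ := ih
    obtain ⟨-, h₄, h₅⟩ := kruskal_bound n (packing n es l).1
    rw [h, FlexCut.packStep, List.length_append, List.length_singleton]
    refine ⟨?_, ?_, ?_⟩
    · simp only [(sortByLoad_perm _).length_eq, kruskal_length, h₁]
    · simp only [csize_perm (sortByLoad_perm _)]
      rw [h₁] at h₄
      nlinarith
    · simp only [csize_cons]
      nlinarith

@[fun_prop]
theorem packing {f : α → ℕ} {g : α → List LoadedEdge} {r : α → List Unit} (hf : PolyTime f)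
    (hg : PolyTime g) (hr : PolyTime r) : PolyTime fun a => packing (f a) (g a) (r a) :=
  foldl (f := fun a st _ => FlexCut.packStep (f a) st) hr (by fun_prop) (by fun_prop)
    (B := fun a => (csize (g a) + 2 * (g a).length * (r a).length) +
      ((r a).length * (csize (g a) + 2 * (g a).length * (r a).length + 1) + 1) + 1)
    (by
      have h₁ := PolyBounded.size hg
      have h₂ := PolyBounded.length hg
      have h₃ := PolyBounded.length hr
      have h₄ := h₁.add (((PolyBounded.const 2).mul h₂).mul h₃)
      exact (h₄.add ((h₃.mul (h₄.add (.const 1))).add (.const 1))).add (.const 1))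
    (fun a l₁ l₂ h => by
      obtain ⟨-, h₂, h₃⟩ := packing_bound (f a) (g a) l₁
      have h₄ : l₁.length ≤ (r a).length := by rw [h]; simp
      change csize (FlexCut.packing (f a) (g a) l₁) ≤ _
      have h₇ : csize (FlexCut.packing (f a) (g a) l₁) = csize (FlexCut.packing (f a) (g a) l₁).1 +
        csize (FlexCut.packing (f a) (g a) l₁).2 + 1 := rfl
      have h₅ : csize (g a) + 2 * (g a).length * l₁.length ≤
        csize (g a) + 2 * (g a).length * (r a).length := by gcongr
      have h₆ := Nat.mul_le_mul h₄ (Nat.succ_le_succ h₅)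
      rw [Nat.succ_eq_add_one, Nat.succ_eq_add_one] at h₆
      omega)

@[fun_prop]
theorem components {f : α → ℕ} {g : α → List LoadedEdge} (hf : PolyTime f) (hg : PolyTime g) :
    PolyTime fun a => components (f a) (g a) :=
  foldl (f := fun _ st e => FlexCut.link st e) hg (by fun_prop) (by fun_prop)
    (B := fun a => f a * (2 * f a + 2) + 1)
    (.add (.mul (.nat hf) (.add (.mul (.const 2) (.nat hf)) (.const 2))) (.const 1))
    (fun a l₁ l₂ _ => by
      refine csize_labels ?_
      clear * -
      induction l₁ using List.reverseRecOn with
      | nil => exact range_bound _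
      | append_singleton l e ih => rw [List.foldl_append]; exact link_bound ih e)

@[fun_prop]
theorem fundamentalCuts {f : α → ℕ} {g : α → List LoadedEdge} (hf : PolyTime f)
    (hg : PolyTime g) : PolyTime fun a => fundamentalCuts (f a) (g a) :=
  map (by fun_prop) (map (by fun_prop) (by fun_prop))

@[fun_prop]
theorem xorBits {f : α → ℕ} {g h : α → List Bool} (hf : PolyTime f) (hg : PolyTime g)
    (hh : PolyTime h) : PolyTime fun a => xorBits (f a) (g a) (h a) :=
  map (by fun_prop) (by fun_prop)

@[fun_prop]
theorem extendBy {f : α → ℕ} {g h : α → List (List Bool)} (hf : PolyTime f) (hg : PolyTime g)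
    (hh : PolyTime h) : PolyTime fun a => extendBy (f a) (g a) (h a) :=
  flatMap hh (cons (by fun_prop) (map (by fun_prop) (by fun_prop)))

/-- Here `r` is fixed and not part of the input: each level costs a further polynomial factor. -/
theorem sums {f : α → ℕ} {g : α → List (List Bool)} (hf : PolyTime f) (hg : PolyTime g) (r : ℕ) :
    PolyTime fun a => sums (f a) (g a) r := by
  induction r with
  | zero =>
    have h (b : Bool) : PolyTime fun a => (List.range (f a)).map fun _ => b :=
      map (by fun_prop) (by fun_prop)
    exact cons (h false) (cons (h true) (const []))
  | succ r ih => exact extendBy hf hg ih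

@[fun_prop]
theorem candidates {f g : α → ℕ} {h : α → List FlaggedEdge} (hf : PolyTime f) (hg : PolyTime g)
    (hh : PolyTime h) : PolyTime fun a => candidates (f a) (g a) (h a) :=
  sums hf (flatMap (snd (packing hf (map hh (by fun_prop)) (flatMap hh (by fun_prop))))
    (by fun_prop)) 8

@[fun_prop]
theorem crosses {f : α → List Bool} {g : α → FlaggedEdge} (hf : PolyTime f) (hg : PolyTime g) :
    PolyTime fun a => crosses (f a) (g a) := by
  unfold FlexCut.crosses; fun_prop

theorem isTight {f : α → ℕ} {g : α → List FlaggedEdge} {h : α → List Bool} (hf : PolyTime f)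
    (hg : PolyTime g) (hh : PolyTime h) : PolyTime fun a => isTight (f a) (g a) (h a) :=
  and (and (and (any hh (by fun_prop)) (any hh (by fun_prop)))
    (eq (countP hg (by fun_prop)) (by fun_prop))) (le (const 2) (countP hg (by fun_prop)))

@[fun_prop]
theorem crossing {f : α → ℕ} {g h : α → List Bool} (hf : PolyTime f) (hg : PolyTime g)
    (hh : PolyTime h) : PolyTime fun a => crossing (f a) (g a) (h a) :=
  and (and (and (any (by fun_prop) (by fun_prop)) (any (by fun_prop) (by fun_prop)))
    (any (by fun_prop) (by fun_prop))) (any (by fun_prop) (by fun_prop))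

@[fun_prop]
theorem redSide {f : α → List FlaggedEdge} {g h : α → List Bool} (hf : PolyTime f)
    (hg : PolyTime g) (hh : PolyTime h) : PolyTime fun a => redSide (f a) (g a) (h a) :=
  or (le (const 2) (countP hf (by fun_prop))) (le (const 2) (countP hf (by fun_prop)))

@[fun_prop]
theorem tightList {f g : α → ℕ} {h : α → List FlaggedEdge} (hf : PolyTime f) (hg : PolyTime g)
    (hh : PolyTime h) : PolyTime fun a => tightList (f a) (g a) (h a) :=
  filter (by fun_prop) (isTight (by fun_prop) (by fun_prop) (by fun_prop))

theorem redList {f g : α → ℕ} {h : α → List FlaggedEdge} (hf : PolyTime f) (hg : PolyTime g)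
    (hh : PolyTime h) : PolyTime fun a => redList (f a) (g a) (h a) :=
  filter (by fun_prop) (all (by fun_prop) (by fun_prop))

theorem blueList {f g : α → ℕ} {h : α → List FlaggedEdge} (hf : PolyTime f) (hg : PolyTime g)
    (hh : PolyTime h) : PolyTime fun a => blueList (f a) (g a) (h a) :=
  filter (by fun_prop) (and (eq (countP (by fun_prop) (by fun_prop)) (by fun_prop))
    (all (by fun_prop) (by fun_prop)))

end PolyTime

end

/-! ### Kruskal's algorithm and the growth of the potential. -/

/-- The edge is in the cut of the set. -/
def separates (S : ℕ → Bool) (e : LoadedEdge) : Bool := S e.2.1 != S e.2.2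

/-- The ends of the edges are smaller than `n`. -/
def Valid (n : ℕ) (es : List LoadedEdge) : Prop := ∀ e ∈ es, e.2.1 < n ∧ e.2.2 < n

/-- The edges chosen by Kruskal's algorithm started at a given labelling. -/
def forest : List ℕ → List LoadedEdge → List LoadedEdge
  | _, [] => []
  | labs, e :: es => bif joined labs e then forest labs es else e :: forest (link labs e) es

/-- All edges, those chosen by Kruskal's algorithm with their load raised by one. -/
def bump : List ℕ → List LoadedEdge → List LoadedEdge
  | _, [] => []
  | labs, e :: es =>
    bif joined labs e then e :: bump labs es else (e.1 + 1, e.2) :: bump (link labs e) es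

/-- Every non-trivial union of classes has at least `k` edges in its cut. -/
def Robust (k : ℕ) (labs : List ℕ) (es : List LoadedEdge) : Prop :=
  ∀ g : ℕ → Bool, (∃ x ∈ labs, g x = true) → (∃ x ∈ labs, g x = false) →
    k ≤ es.countP (separates fun v => g (labs.getD v 0))

theorem kruskal_fold (labs : List ℕ) (es o T : List LoadedEdge) :
    (es.foldl kruskalStep (labs, o, T)).2 =
      ((bump labs es).reverse ++ o, (forest labs es).reverse ++ T) := by
  induction es generalizing labs o T with
  | nil => simp [bump, forest]
  | cons e es ih =>
    rw [List.foldl_cons, kruskalStep]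
    cases h : joined labs e <;> simp [ih, bump, forest, h]

theorem kruskal_eq (n : ℕ) (es : List LoadedEdge) : (kruskal n es).2 =
    ((bump (List.range n) es).reverse, (forest (List.range n) es).reverse) := by
  simp [kruskal, kruskal_fold]

theorem link_length (labs : List ℕ) (e : LoadedEdge) : (link labs e).length = labs.length := by
  simp [link]

theorem getD_map_lt {α β : Type} {l : List α} {f : α → β} {i : ℕ} {a : α} {b : β}
    (h : i < l.length) : (l.map f).getD i b = f (l.getD i a) := by
  simp [List.getD_eq_getElem?_getD, h]

theorem getD_mem {α : Type} {l : List α} {i : ℕ} {a : α} (h : i < l.length) : l.getD i a ∈ l := by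
  rw [List.getD_eq_getElem _ _ h]; exact List.getElem_mem h

theorem link_getD {labs : List ℕ} (e : LoadedEdge) {v : ℕ} (hv : v < labs.length) :
    (link labs e).getD v 0 = bif decide (labs.getD v 0 = labs.getD e.2.2 0)
      then labs.getD e.2.1 0 else labs.getD v 0 :=
  getD_map_lt hv

theorem link_of_joined {labs : List ℕ} {e : LoadedEdge} (h : joined labs e = true) :
    link labs e = labs := by
  have h : labs.getD e.2.1 0 = labs.getD e.2.2 0 := by simpa [joined] using h
  conv_rhs => rw [← List.map_id labs]
  refine List.map_congr_left fun x _ => ?_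
  cases hx : decide (x = labs.getD e.2.2 0)
  · rfl
  · rw [h]; simpa using (of_decide_eq_true hx).symm

theorem Valid.tail {n : ℕ} {e : LoadedEdge} {es : List LoadedEdge} (h : Valid n (e :: es)) :
    Valid n es := fun f hf => h f (List.mem_cons_of_mem _ hf)

/-- A union of classes after the merge pulls back along the relabelling to a union of classes before
it, and `e` is not in its cut because its ends have been identified. -/
theorem Robust.link {k : ℕ} {labs : List ℕ} {e : LoadedEdge} {es : List LoadedEdge}
    (h : Robust k labs (e :: es)) (hv : Valid labs.length (e :: es)) :
    Robust k (link labs e) es := by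
  intro g hg₁ hg₂
  let φ : ℕ → ℕ := fun x => bif decide (x = labs.getD e.2.2 0) then labs.getD e.2.1 0 else x
  have hφ : ∀ v, v < labs.length → (FlexCut.link labs e).getD v 0 = φ (labs.getD v 0) :=
    fun v hv => link_getD e hv
  have hmem : ∀ x ∈ FlexCut.link labs e, ∃ y ∈ labs, φ y = x := fun x hx => List.mem_map.1 hx
  have key := h (fun x => g (φ x))
    (by obtain ⟨x, hx, h₁⟩ := hg₁; obtain ⟨y, hy, rfl⟩ := hmem x hx; exact ⟨y, hy, h₁⟩)
    (by obtain ⟨x, hx, h₁⟩ := hg₂; obtain ⟨y, hy, rfl⟩ := hmem x hx; exact ⟨y, hy, h₁⟩)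
  have hhead : φ (labs.getD e.2.1 0) = φ (labs.getD e.2.2 0) := by
    simp only [φ, decide_true, cond_true]
    cases decide (labs.getD e.2.1 0 = labs.getD e.2.2 0) <;> rfl
  rw [List.countP_cons_of_neg (by simp only [separates, hhead, bne_self_eq_false]; exact Bool.false_ne_true)] at key
  refine key.trans_eq (List.countP_congr fun f hf => ?_)
  obtain ⟨h₁, h₂⟩ := hv.tail f hf
  simp only [separates, hφ _ h₁, hφ _ h₂]

theorem Robust.tail {k : ℕ} {labs : List ℕ} {e : LoadedEdge} {es : List LoadedEdge}
    (h : Robust k labs (e :: es)) (hv : Valid labs.length (e :: es)) (hj : joined labs e = true) :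
    Robust k labs es := by
  simpa only [link_of_joined hj] using h.link hv

theorem card_le_link (labs : List ℕ) (e : LoadedEdge) :
    #labs.toFinset ≤ #(link labs e).toFinset + 1 := by
  have : labs.toFinset ⊆ insert (labs.getD e.2.2 0) (link labs e).toFinset := by
    intro x hx
    rw [Finset.mem_insert, List.mem_toFinset, link, List.mem_map]
    by_cases h : x = labs.getD e.2.2 0
    · exact .inl h
    · exact .inr ⟨x, List.mem_toFinset.1 hx, by rw [decide_eq_false h, cond_false]⟩
  exact (card_le_card this).trans (card_insert_le _ _)

theorem card_link_lt {labs : List ℕ} {e : LoadedEdge} (h₁ : e.2.1 < labs.length)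
    (h₂ : e.2.2 < labs.length) (h : joined labs e = false) :
    #(link labs e).toFinset < #labs.toFinset := by
  have h : labs.getD e.2.1 0 ≠ labs.getD e.2.2 0 := by simpa [joined] using h
  refine card_lt_card ⟨fun x hx => ?_, fun hs => ?_⟩
  · rw [List.mem_toFinset, link, List.mem_map] at hx
    obtain ⟨y, hy, rfl⟩ := hx
    cases decide (y = labs.getD e.2.2 0)
    · exact List.mem_toFinset.2 hy
    · exact List.mem_toFinset.2 (getD_mem h₁)
  · have := hs (List.mem_toFinset.2 (getD_mem (a := 0) h₂))
    rw [List.mem_toFinset, link, List.mem_map] at this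
    obtain ⟨y, -, hy⟩ := this
    by_cases hy' : y = labs.getD e.2.2 0
    · simp only [hy', decide_true, cond_true] at hy; exact h hy
    · simp only [hy', decide_false, cond_false] at hy

/-- Each chosen edge destroys a class, and at least one class survives. -/
theorem forest_length_lt {labs : List ℕ} {es : List LoadedEdge} (hl : labs ≠ [])
    (hv : Valid labs.length es) : (forest labs es).length < #labs.toFinset := by
  induction es generalizing labs with
  | nil =>
    rw [forest, List.length_nil, Finset.card_pos]
    obtain ⟨x, hx⟩ := List.exists_mem_of_ne_nil _ hl
    exact ⟨x, List.mem_toFinset.2 hx⟩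
  | cons e es ih =>
    rw [forest]
    cases h : joined labs e
    · have h₁ := hv e (by simp)
      have h₂ := card_link_lt h₁.1 h₁.2 h
      have h₃ := ih (labs := link labs e) (by simpa [link] using hl)
        (by rw [link_length]; exact hv.tail)
      rw [cond_false, List.length_cons]; omega
    · exact ih hl hv.tail

/-- Handshake count: an edge lies in the cuts of at most two classes. -/
theorem sum_countP_le (F : Finset ℕ) (f : ℕ → ℕ) (es : List LoadedEdge) :
    ∑ x ∈ F, es.countP (separates fun v => decide (f v = x)) ≤ 2 * es.length := by
  induction es with
  | nil => simp
  | cons e es ih =>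
    simp only [List.countP_cons, sum_add_distrib, List.length_cons]
    have : ∀ a : ℕ, ∑ x ∈ F, (if a = x then 1 else 0) ≤ 1 := fun a => by
      rw [sum_ite_eq]; split <;> omega
    have h₁ : ∑ x ∈ F, (if (separates (fun v => decide (f v = x)) e) = true then 1 else 0) ≤
        ∑ x ∈ F, ((if f e.2.1 = x then 1 else 0) + if f e.2.2 = x then 1 else 0) := by
      refine sum_le_sum fun x _ => ?_
      by_cases h₁ : f e.2.1 = x <;> by_cases h₂ : f e.2.2 = x <;> simp [separates, h₁, h₂]
    rw [sum_add_distrib] at h₁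
    have h₂ := this (f e.2.1)
    have h₃ := this (f e.2.2)
    omega

/-- Each of the N classes has at least `k` edges in its cut, so kN ≤ 2·|es| by the handshake count,
while the forest has fewer than N edges. The case of a single class has an empty forest. -/
theorem Robust.forest_length {k : ℕ} {labs : List ℕ} {es : List LoadedEdge}
    (h : Robust k labs es) (hl : labs ≠ []) (hv : Valid labs.length es) :
    k * (forest labs es).length ≤ 2 * es.length := by
  have hlt := forest_length_lt hl hv
  rcases lt_or_ge 1 #labs.toFinset with hc | hc
  · have h₁ : #labs.toFinset * k ≤
        ∑ x ∈ labs.toFinset, es.countP (separates fun v => decide (labs.getD v 0 = x)) := by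
      rw [← smul_eq_mul]
      refine card_nsmul_le_sum _ _ _ fun x hx => ?_
      obtain ⟨y, hy, hxy⟩ := exists_mem_ne hc x
      exact h (fun v => decide (v = x)) ⟨x, List.mem_toFinset.1 hx, by simp⟩
        ⟨y, List.mem_toFinset.1 hy, by simpa using hxy⟩
    have h₂ := sum_countP_le labs.toFinset (fun v => labs.getD v 0) es
    have : k * (forest labs es).length ≤ #labs.toFinset * k := by
      rw [mul_comm]; gcongr
    omega
  · rw [show (forest labs es).length = 0 by omega]; omega

/-- The total weight, where load `w` has weight `2 ^ w`. -/
def potential (es : List LoadedEdge) : ℕ := (es.map fun e => 2 ^ e.1).sum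

/-- Abel summation: `Robust.forest_length` holds for every suffix of the sorted list, with the
classes reached at that point, and the weights increase. With subtraction the claim reads k·∑(w − c)
over the forest ≤ 2·∑(w − c) over all edges. -/
theorem Robust.potential_forest_aux {k : ℕ} {labs : List ℕ} {es : List LoadedEdge}
    (h : Robust k labs es) (hl : labs ≠ []) (hv : Valid labs.length es)
    (hs : es.Pairwise fun e f => e.1 ≤ f.1) (c : ℕ) (hc : ∀ e ∈ es, c ≤ 2 ^ e.1) :
    k * potential (forest labs es) + 2 * es.length * c ≤
      2 * potential es + k * (forest labs es).length * c := by
  induction es generalizing labs c with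
  | nil => simp [forest, potential]
  | cons e es ih =>
    have hlen := h.forest_length hl hv
    have hw := hc e (by simp)
    obtain ⟨d, hd⟩ := Nat.exists_eq_add_of_le hw
    have hs' := List.pairwise_cons.1 hs
    have hc' : ∀ f ∈ es, 2 ^ e.1 ≤ 2 ^ f.1 := fun f hf =>
      Nat.pow_le_pow_right (by norm_num) (hs'.1 f hf)
    have hp : potential (e :: es) = 2 ^ e.1 + potential es := by simp [potential]
    -- It is enough to take for `c` the smallest weight, that of the head: lowering `c` by `d` costs
    -- k·|forest|·d ≤ 2·|es|·d.
    suffices hmain : k * potential (forest labs (e :: es)) + 2 * (e :: es).length * 2 ^ e.1 ≤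
        2 * potential (e :: es) + k * (forest labs (e :: es)).length * 2 ^ e.1 by
      have := Nat.mul_le_mul_right d hlen
      rw [hd] at hmain
      nlinarith
    rw [hp, List.length_cons, forest]
    cases hj : joined labs e
    · have := ih (h.link hv) (by simpa [FlexCut.link] using hl)
        (by rw [link_length]; exact hv.tail) hs'.2 _ hc'
      have hq : potential (e :: forest (FlexCut.link labs e) es) =
        2 ^ e.1 + potential (forest (FlexCut.link labs e) es) := by simp [potential]
      rw [cond_false, hq, List.length_cons]
      nlinarith
    · have := ih (h.tail hv hj) hl hv.tail hs'.2 _ hc'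
      rw [cond_true]
      nlinarith

theorem Robust.potential_forest {k : ℕ} {labs : List ℕ} {es : List LoadedEdge}
    (h : Robust k labs es) (hl : labs ≠ []) (hv : Valid labs.length es)
    (hs : es.Pairwise fun e f => e.1 ≤ f.1) :
    k * potential (forest labs es) ≤ 2 * potential es := by
  simpa using h.potential_forest_aux hl hv hs 0 (by simp)

/-- Raising a load by one doubles the weight, that is, adds the old weight once more. -/
theorem potential_bump (labs : List ℕ) (es : List LoadedEdge) :
    potential (bump labs es) = potential es + potential (forest labs es) := by
  induction es generalizing labs with
  | nil => rfl
  | cons e es ih =>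
    have hp : ∀ f fs, potential (f :: fs) = 2 ^ f.1 + potential fs := by simp [potential]
    rw [bump, forest]
    cases joined labs e <;> simp only [cond_true, cond_false, hp, ih, pow_succ] <;> omega

theorem map_snd_bump (labs : List ℕ) (es : List LoadedEdge) :
    (bump labs es).map Prod.snd = es.map Prod.snd := by
  induction es generalizing labs with
  | nil => rfl
  | cons e es ih => rw [bump]; cases joined labs e <;> simp [ih]

/-- The total load of a cut. -/
def cutLoad (S : ℕ → Bool) (es : List LoadedEdge) : ℕ :=
  (es.map fun e => bif separates S e then e.1 else 0).sum

theorem cutLoad_bump (S : ℕ → Bool) (labs : List ℕ) (es : List LoadedEdge) :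
    cutLoad S (bump labs es) = cutLoad S es + (forest labs es).countP (separates S) := by
  induction es generalizing labs with
  | nil => rfl
  | cons e es ih =>
    have hp : ∀ f fs, cutLoad S (f :: fs) = (bif separates S f then f.1 else 0) + cutLoad S fs := by
      simp [cutLoad]
    rw [bump, forest]
    cases joined labs e
    · have : separates S (e.1 + 1, e.2) = separates S e := rfl
      simp only [cond_false, hp, ih, List.countP_cons, this]
      cases separates S e
      · simp
      · simp; omega
    · simp only [cond_true, hp, ih]; omega

theorem insertByLoad_sorted {l : List LoadedEdge} (h : l.Pairwise fun e f => e.1 ≤ f.1)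
    (e : LoadedEdge) : (insertByLoad l e).Pairwise fun e f => e.1 ≤ f.1 := by
  rw [insertByLoad, List.pairwise_append, List.pairwise_cons]
  refine ⟨h.filter _, ⟨fun f hf => ?_, h.filter _⟩, fun f hf g hg => ?_⟩
  · have := (List.mem_filter.1 hf).2
    simp at this; omega
  · have h₁ := (List.mem_filter.1 hf).2
    rcases List.mem_cons.1 hg with rfl | hg
    · simpa using h₁
    · have := (List.mem_filter.1 hg).2
      simp at this h₁; omega

theorem sortByLoad_sorted (es : List LoadedEdge) :
    (sortByLoad es).Pairwise fun e f => e.1 ≤ f.1 := by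
  induction es using List.reverseRecOn with
  | nil => exact List.Pairwise.nil
  | append_singleton l e ih =>
    rw [sortByLoad, List.foldl_append]; exact insertByLoad_sorted ih e

theorem countP_of_perm {S : ℕ → Bool} {es fs : List LoadedEdge}
    (h : (es.map Prod.snd).Perm (fs.map Prod.snd)) :
    es.countP (separates S) = fs.countP (separates S) := by
  have (l : List LoadedEdge) : l.countP (separates S) =
      (l.map Prod.snd).countP fun p : ℕ × ℕ => S p.1 != S p.2 := by
    rw [List.countP_map]; rfl
  rw [this, this, h.countP_eq]

theorem Robust.of_perm {k : ℕ} {labs : List ℕ} {es fs : List LoadedEdge} (h : Robust k labs es)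
    (hp : (es.map Prod.snd).Perm (fs.map Prod.snd)) : Robust k labs fs :=
  fun g h₁ h₂ => (h g h₁ h₂).trans_eq (countP_of_perm hp)

theorem Valid.of_perm {n : ℕ} {es fs : List LoadedEdge} (h : Valid n es)
    (hp : (es.map Prod.snd).Perm (fs.map Prod.snd)) : Valid n fs := by
  intro f hf
  have : f.2 ∈ es.map Prod.snd := hp.mem_iff.2 (List.mem_map_of_mem hf)
  obtain ⟨e, he, h₁⟩ := List.mem_map.1 this
  rw [← h₁]; exact h e he

/-! ### Spanning trees and the load of a cut under greedy packing. -/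

/-- A list of edges that forms a spanning tree on `{0, …, n - 1}`. -/
structure IsTree (n : ℕ) (T : List LoadedEdge) : Prop where
  valid : Valid n T
  length_lt : T.length < n
  spanning : ∀ Y : ℕ → Bool, (∀ e ∈ T, separates Y e = false) → ∀ u < n, ∀ v < n, Y u = Y v

theorem forest_subset (labs : List ℕ) (es : List LoadedEdge) : forest labs es ⊆ es := by
  induction es generalizing labs with
  | nil => exact List.Subset.refl _
  | cons e es ih =>
    rw [forest]
    cases joined labs e
    · exact List.cons_subset_cons _ (ih _)
    · exact fun f hf => List.mem_cons_of_mem _ (ih _ hf)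

theorem link_compatible {labs : List ℕ} {e : LoadedEdge} (h₁ : e.2.1 < labs.length)
    (h₂ : e.2.2 < labs.length) {Y : ℕ → Bool} (hY : separates Y e = false)
    (h : ∀ u < labs.length, ∀ v < labs.length, labs.getD u 0 = labs.getD v 0 → Y u = Y v) :
    ∀ u < labs.length, ∀ v < labs.length,
      (link labs e).getD u 0 = (link labs e).getD v 0 → Y u = Y v := by
  have hY : Y e.2.1 = Y e.2.2 := by simpa [separates] using hY
  intro u hu v hv
  rw [link_getD e hu, link_getD e hv]
  by_cases hu' : labs.getD u 0 = labs.getD e.2.2 0 <;>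
    by_cases hv' : labs.getD v 0 = labs.getD e.2.2 0
  · intro _; exact h u hu v hv (hu'.trans hv'.symm)
  · simp only [hu', hv', decide_true, decide_false, cond_true, cond_false]
    intro h₃; rw [h u hu _ h₂ hu', ← hY, h _ h₁ v hv h₃]
  · simp only [hu', hv', decide_true, decide_false, cond_true, cond_false]
    intro h₃; rw [h v hv _ h₂ hv', ← hY, h u hu _ h₁ h₃]
  · simp only [hu', hv', decide_false, cond_false]
    exact h u hu v hv

/-- A set whose cut avoids the forest remains a union of classes through all merges, and at the end
only one class is left. -/
theorem Robust.forest_spanning {k : ℕ} (hk : 0 < k) {labs : List ℕ} {es : List LoadedEdge}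
    (h : Robust k labs es) (hv : Valid labs.length es) {Y : ℕ → Bool}
    (hY : ∀ e ∈ forest labs es, separates Y e = false)
    (hc : ∀ u < labs.length, ∀ v < labs.length, labs.getD u 0 = labs.getD v 0 → Y u = Y v) :
    ∀ u < labs.length, ∀ v < labs.length, Y u = Y v := by
  induction es generalizing labs with
  | nil =>
    intro u hu v hv
    refine hc u hu v hv ?_
    -- Two distinct classes with no edges left would contradict robustness, as `k` is positive.
    by_contra hne
    have := h (fun x => decide (x = labs.getD u 0)) ⟨_, getD_mem hu, decide_eq_true rfl⟩
      ⟨_, getD_mem hv, by simpa using fun h => hne h.symm⟩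
    simp at this; omega
  | cons e es ih =>
    have h₁ := hv e (by simp)
    rw [forest] at hY
    cases hj : joined labs e
    · rw [hj, cond_false] at hY
      have := ih (h.link hv) (by rw [link_length]; exact hv.tail) (fun f hf => hY f (by simp [hf]))
        (by rw [link_length]; exact link_compatible h₁.1 h₁.2 (hY e (by simp)) hc)
      rwa [link_length] at this
    · rw [hj, cond_true] at hY
      exact ih (h.tail hv hj) hv.tail hY hc

theorem range_getD {n v : ℕ} (hv : v < n) : (List.range n).getD v 0 = v := by
  simp [List.getD_eq_getElem?_getD, hv]

theorem Robust.isTree {k n : ℕ} (hk : 0 < k) (hn : 0 < n) {es : List LoadedEdge}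
    (h : Robust k (List.range n) es) (hv : Valid n es) :
    IsTree n (forest (List.range n) es).reverse := by
  have hv' : Valid (List.range n).length es := by rwa [List.length_range]
  refine ⟨fun e he => hv e (forest_subset _ _ (List.mem_reverse.1 he)), ?_, fun Y hY => ?_⟩
  · have := forest_length_lt (by simpa using hn.ne') hv'
    simpa [List.toFinset_range] using this
  · have := h.forest_spanning hk hv' (Y := Y) (fun e he => hY e (List.mem_reverse.2 he)) (by
      rw [List.length_range]
      intro u hu v hv huv
      rw [range_getD hu, range_getD hv] at huv
      rw [huv])
    rwa [List.length_range] at this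

/-- What is known about the state of the greedy tree packing after `l` rounds. -/
structure PackingSpec (k n : ℕ) (es : List LoadedEdge) (l : ℕ)
    (st : List LoadedEdge × List (List LoadedEdge)) : Prop where
  sorted : st.1.Pairwise fun e f => e.1 ≤ f.1
  perm : (es.map Prod.snd).Perm (st.1.map Prod.snd)
  potential : k ^ l * potential st.1 ≤ (k + 2) ^ l * potential es
  load : ∀ S, cutLoad S st.1 = cutLoad S es + (st.2.map fun T => T.countP (separates S)).sum
  length : st.2.length = l
  tree : ∀ T ∈ st.2, IsTree n T

/-- The factor per round is 1 + 2/k, by `Robust.potential_forest` and `potential_bump`. Re-sorting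
after each round keeps the next forest a minimum one, and permuting or reloading edges does not
affect cut sizes. -/
theorem packing_spec {k n : ℕ} (hk : 0 < k) (hn : 0 < n) {es : List LoadedEdge}
    (h : Robust k (List.range n) es) (hv : Valid n es) (hs : es.Pairwise fun e f => e.1 ≤ f.1)
    (l : List Unit) : PackingSpec k n es l.length (packing n es l) := by
  induction l using List.reverseRecOn with
  | nil => exact ⟨hs, .refl _, by simp [packing], by simp [packing], rfl, by simp [packing]⟩
  | append_singleton l u ih =>
    have hstep : packing n es (l ++ [u]) = packStep n (packing n es l) := by
      simp [packing, List.foldl_append]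
    rw [hstep, List.length_append, List.length_singleton]
    obtain ⟨h₁, h₂, h₃, h₄, h₅, h₆⟩ := ih
    generalize packing n es l = st at *
    have hr := h.of_perm h₂
    have hv' := hv.of_perm h₂
    have hp : (sortByLoad (kruskal n st.1).2.1).Perm (bump (List.range n) st.1) := by
      rw [kruskal_eq]; exact (sortByLoad_perm _).trans (List.reverse_perm _)
    have hpot := hr.potential_forest (by simpa using hn.ne') (by rwa [List.length_range]) h₁
    refine ⟨sortByLoad_sorted _, ?_, ?_, fun S => ?_, ?_, ?_⟩
    · refine h₂.trans ?_
      rw [← map_snd_bump (List.range n) st.1]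
      exact (hp.map _).symm
    · have : FlexCut.potential (packStep n st).1 = FlexCut.potential (bump (List.range n) st.1) :=
        (hp.map _).sum_eq
      rw [this, potential_bump, pow_succ, pow_succ]
      calc k ^ l.length * k * (FlexCut.potential st.1 +
            FlexCut.potential (forest (List.range n) st.1))
          = k ^ l.length * (k * FlexCut.potential st.1 +
            k * FlexCut.potential (forest (List.range n) st.1)) := by ring
        _ ≤ k ^ l.length * (k * FlexCut.potential st.1 + 2 * FlexCut.potential st.1) := by gcongr
        _ = (k ^ l.length * FlexCut.potential st.1) * (k + 2) := by ring
        _ ≤ ((k + 2) ^ l.length * FlexCut.potential es) * (k + 2) := by gcongr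
        _ = _ := by ring
    · have : cutLoad S (packStep n st).1 = cutLoad S (bump (List.range n) st.1) :=
        (hp.map _).sum_eq
      rw [this, cutLoad_bump, h₄]
      simp only [packStep, kruskal_eq, List.map_cons, List.sum_cons, List.countP_reverse]
      omega
    · simp [packStep, h₅]
    · intro T hT
      rcases List.mem_cons.1 hT with rfl | hT
      · rw [kruskal_eq]; exact hr.isTree hk hn hv'
      · exact h₆ T hT

/-- (1 + 2/k)^k ≤ e² < 8. -/
theorem add_two_pow_le (k : ℕ) : (k + 2) ^ k ≤ 8 * k ^ k := by
  rcases Nat.eq_zero_or_pos k with rfl | hk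
  · simp
  have hk' : (0 : ℝ) < k := by exact_mod_cast hk
  have h₁ : (2 / k + 1 : ℝ) ≤ Real.exp (2 / k) := Real.add_one_le_exp _
  have h₂ : (2 / k + 1 : ℝ) ^ k ≤ Real.exp 2 := by
    calc (2 / k + 1 : ℝ) ^ k ≤ Real.exp (2 / k) ^ k := by gcongr
      _ = Real.exp 2 := by rw [← Real.exp_nat_mul]; congr 1; field_simp
  have h₃ : Real.exp 2 ≤ 8 := by
    have h₄ := Real.exp_one_lt_d9
    have h₅ : Real.exp 2 = Real.exp 1 * Real.exp 1 := by rw [← Real.exp_add]; norm_num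
    have h₆ := Real.exp_pos 1
    rw [h₅]; nlinarith
  have h₄ : ((k : ℝ) + 2) ^ k = (2 / k + 1 : ℝ) ^ k * k ^ k := by
    rw [← mul_pow]; congr 1; field_simp; ring
  have : ((k : ℝ) + 2) ^ k ≤ 8 * k ^ k := by
    rw [h₄]; gcongr; exact h₂.trans h₃
  exact_mod_cast this

theorem le_potential {e : LoadedEdge} {es : List LoadedEdge} (h : e ∈ es) :
    2 ^ e.1 ≤ potential es :=
  List.single_le_sum (fun _ _ => Nat.zero_le _) _ (List.mem_map_of_mem h)

theorem cutLoad_le {S : ℕ → Bool} {es : List LoadedEdge} {M : ℕ} (h : ∀ e ∈ es, e.1 ≤ M) :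
    cutLoad S es ≤ es.countP (separates S) * M := by
  induction es with
  | nil => simp [cutLoad]
  | cons e es ih =>
    have h₁ := h e (by simp)
    have h₂ := ih fun f hf => h f (by simp [hf])
    have hp : cutLoad S (e :: es) = (bif separates S e then e.1 else 0) + cutLoad S es := by
      simp [cutLoad]
    rw [hp, List.countP_cons]
    cases separates S e
    · simpa using h₂
    · simp only [cond_true, if_true]; nlinarith

/-- Averaging: the load of the cut counts its crossings with all trees, and even loads leave too
little room for nine crossings per tree. -/
theorem exists_tree {k n : ℕ} (hk : 0 < k) (hn : 0 < n) {es : List LoadedEdge}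
    (h : Robust k (List.range n) es) (hv : Valid n es) (h₀ : ∀ e ∈ es, e.1 = 0)
    {l : List Unit} (hl : l.length = k * es.length) {S : ℕ → Bool}
    (hS : es.countP (separates S) ≤ k + 1) (hm : es ≠ []) :
    ∃ T ∈ (packing n es l).2, IsTree n T ∧ T.countP (separates S) ≤ 8 := by
  have hs : es.Pairwise fun e f => e.1 ≤ f.1 :=
    List.pairwise_of_forall_mem_list fun e he f _ => by rw [h₀ e he]; exact Nat.zero_le _
  obtain ⟨-, h₂, h₃, h₄, h₅, h₆⟩ := packing_spec hk hn h hv hs l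
  generalize packing n es l = st at *
  have hm' : 0 < es.length := List.length_pos_iff.2 hm
  have hpot : potential es = es.length := by
    rw [potential, List.map_congr_left (g := fun _ => 1) fun e he => by rw [h₀ e he, pow_zero]]
    simp
  have hcut : cutLoad S es = 0 := by
    have := cutLoad_le (S := S) (M := 0) fun e he => (h₀ e he).le
    omega
  -- After km rounds, m being the number of edges, the potential is at most 8^m · m ≤ 2^(4m), and
  -- every single weight is at most the potential.
  have hload : ∀ e ∈ st.1, e.1 ≤ 4 * es.length := by
    intro e he
    have h₇ := le_potential he
    rw [hl, hpot, pow_mul, pow_mul] at h₃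
    have h₈ : ((k + 2) ^ k) ^ es.length ≤ (8 * k ^ k) ^ es.length :=
      Nat.pow_le_pow_left (add_two_pow_le k) _
    have h₉ : (k ^ k) ^ es.length * 2 ^ e.1 ≤ (k ^ k) ^ es.length * (8 ^ es.length * es.length) := by
      calc _ ≤ (k ^ k) ^ es.length * potential st.1 := by gcongr
        _ ≤ ((k + 2) ^ k) ^ es.length * es.length := h₃
        _ ≤ (8 * k ^ k) ^ es.length * es.length := by gcongr
        _ = _ := by rw [mul_pow]; ring
    have h₁₀ := Nat.le_of_mul_le_mul_left h₉ (by positivity)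
    have h₁₁ : 2 ^ e.1 ≤ 2 ^ (4 * es.length) := by
      calc _ ≤ 8 ^ es.length * es.length := h₁₀
        _ ≤ 8 ^ es.length * 2 ^ es.length := by gcongr; exact Nat.lt_two_pow_self.le
        _ = _ := by rw [← mul_pow, pow_mul]; norm_num
    exact (Nat.pow_le_pow_iff_right (by norm_num)).1 h₁₁
  by_contra hcon
  push Not at hcon
  have h₇ : 9 * st.2.length ≤ (st.2.map fun T => T.countP (separates S)).sum := by
    have := List.card_nsmul_le_sum (st.2.map fun T => T.countP (separates S)) 9 (by
      intro c hc
      obtain ⟨T, hT, rfl⟩ := List.mem_map.1 hc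
      exact hcon T hT (h₆ T hT))
    simp only [List.length_map, smul_eq_mul] at this
    omega
  have h₈ := cutLoad_le (S := S) hload
  rw [h₄, hcut, ← countP_of_perm h₂] at h₈
  rw [h₅, hl] at h₇
  -- Nine crossings per tree would give load at least 9km, but at most k+1 ≤ 2k edges of load at
  -- most 4m carry only 8km.
  have h₉ := Nat.mul_le_mul_right (4 * es.length) hS
  have : 0 < k * es.length := Nat.mul_pos hk hm'
  nlinarith

/-! ### Fundamental cuts and the completeness of the candidate list. -/

theorem components_length (n : ℕ) (es : List LoadedEdge) : (components n es).length = n := by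
  induction es using List.reverseRecOn with
  | nil => exact List.length_range
  | append_singleton l e ih => rw [components, List.foldl_append]; exact (link_length _ _).trans ih

/-- Each edge merges at most one pair of classes. -/
theorem card_components (n : ℕ) (es : List LoadedEdge) :
    n ≤ #(components n es).toFinset + es.length := by
  induction es using List.reverseRecOn with
  | nil => simp [components, List.toFinset_range]
  | append_singleton l e ih =>
    have := card_le_link (components n l) e
    have h : components n (l ++ [e]) = link (components n l) e := by
      simp [components, List.foldl_append]
    rw [h, List.length_append, List.length_singleton]; omega

theorem components_joined {n : ℕ} {es : List LoadedEdge} (hv : Valid n es) :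
    ∀ e ∈ es, (components n es).getD e.2.1 0 = (components n es).getD e.2.2 0 := by
  induction es using List.reverseRecOn with
  | nil => simp
  | append_singleton l f ih =>
    have h : components n (l ++ [f]) = link (components n l) f := by
      simp [components, List.foldl_append]
    intro e he
    have h₁ := hv e he
    have hl := components_length n l
    rw [h, link_getD f (by omega), link_getD f (by omega)]
    rcases List.mem_append.1 he with he | he
    · rw [ih (fun e he => hv e (by simp [he])) e he]
    · rw [List.mem_singleton.1 he]
      simp only [decide_true, cond_true]
      cases decide ((components n l).getD f.2.1 0 = (components n l).getD f.2.2 0) <;> rfl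

/-- Each edge of a tree is the only one in some fundamental cut. -/
theorem IsTree.exists_fundamentalCut {n : ℕ} {T : List LoadedEdge} (hT : IsTree n T)
    {i : ℕ} (hi : i < T.length) : ∃ X ∈ fundamentalCuts n T,
      separates (fun v => X.getD v false) T[i] = true ∧
      ∀ f ∈ T.take i ++ T.drop (i + 1), separates (fun v => X.getD v false) f = false := by
  set R := T.take i ++ T.drop (i + 1) with hR
  have hsplit : T = T.take i ++ T[i] :: T.drop (i + 1) := by
    rw [← List.drop_eq_getElem_cons hi, List.take_append_drop]
  have hvR : Valid n R := fun f hf => hT.valid f (by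
    rw [hsplit]; rw [hR] at hf; simp only [List.mem_append, List.mem_cons] at hf ⊢; tauto)
  have hlen : R.length + 1 = T.length := by
    conv_rhs => rw [hsplit]
    simp [hR]; omega
  have hc := components_length n R
  have hj := components_joined hvR
  have hcard := card_components n R
  obtain ⟨hi₁, hi₂⟩ := hT.valid T[i] (List.getElem_mem hi)
  have hget : ∀ v < n, ((components n R).map fun x =>
      decide (x = (components n R).getD (T.getD i (0, 0, 0)).2.1 0)).getD v false =
      decide ((components n R).getD v 0 = (components n R).getD T[i].2.1 0) := by
    intro v hv
    rw [getD_map_lt (a := 0) (by omega), List.getD_eq_getElem _ _ hi]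
  refine ⟨_, List.mem_map.2 ⟨i, List.mem_range.2 hi, rfl⟩, ?_, fun f hf => ?_⟩
  · rw [← hR]
    simp only [separates, hget _ hi₁, hget _ hi₂]
    -- If the ends of the deleted edge had equal labels, the labels would be constant along all of
    -- `T` and hence everywhere; but fewer than n − 1 remaining edges leave at least two labels.
    by_contra hne
    have hne : (components n R).getD T[i].2.2 0 = (components n R).getD T[i].2.1 0 := by
      simpa using hne
    have hall : ∀ u < n, ∀ v < n, (components n R).getD u 0 = (components n R).getD v 0 := by
      intro u hu v hv
      have := hT.spanning
        (fun w => decide ((components n R).getD w 0 = (components n R).getD v 0)) (fun f hf => by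
          have : (components n R).getD f.2.1 0 = (components n R).getD f.2.2 0 := by
            rw [hsplit] at hf
            rcases List.mem_append.1 hf with hf | hf
            · exact hj f (by simp [hR, hf])
            · rcases List.mem_cons.1 hf with rfl | hf
              · exact hne.symm
              · exact hj f (by simp [hR, hf])
          simp only [separates, this, bne_self_eq_false]) u hu v hv
      simpa using this
    have h₁ : #(components n R).toFinset ≤ 1 := by
      refine card_le_one.2 fun x hx y hy => ?_
      obtain ⟨u, hu, rfl⟩ := List.getElem_of_mem (List.mem_toFinset.1 hx)
      obtain ⟨v, hv, rfl⟩ := List.getElem_of_mem (List.mem_toFinset.1 hy)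
      have := hall u (by omega) v (by omega)
      rwa [List.getD_eq_getElem _ _ hu, List.getD_eq_getElem _ _ hv] at this
    have := hT.length_lt
    omega
  · rw [← hR]
    obtain ⟨h₁, h₂⟩ := hvR f hf
    simp only [separates, hget _ h₁, hget _ h₂, hj f hf, bne_self_eq_false]

theorem xorBits_getD {n v : ℕ} (A B : List Bool) (hv : v < n) :
    (xorBits n A B).getD v false = (A.getD v false != B.getD v false) := by
  rw [xorBits, getD_map_lt (a := 0) (by simpa using hv), range_getD hv]

/-- Adding to `S` the fundamental cut of a tree edge in its cut removes that edge from the cut and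
changes no other tree edge. A set with no tree edge in its cut is constant, which is why `sums`
starts from both constant bit lists. -/
theorem IsTree.mem_sums {n : ℕ} {T : List LoadedEdge} (hT : IsTree n T) {X : List (List Bool)}
    (hX : fundamentalCuts n T ⊆ X) (r : ℕ) (S : ℕ → Bool) (hS : T.countP (separates S) ≤ r) :
    ∃ A ∈ sums n X r, ∀ v < n, A.getD v false = S v := by
  induction r generalizing S with
  | zero =>
    have h₁ : ∀ e ∈ T, separates S e = false := by
      simpa [List.countP_eq_zero] using hS
    have h₂ := hT.spanning S h₁
    have hn : 0 < n := by have := hT.length_lt; omega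
    have hb (b : Bool) : ∀ v < n, ((List.range n).map fun _ => b).getD v false = b := fun v hv => by
      rw [getD_map_lt (a := 0) (by simpa using hv)]
    refine ⟨(List.range n).map fun _ => S 0, ?_, fun v hv => (hb _ v hv).trans (h₂ 0 hn v hv)⟩
    cases S 0 <;> simp [sums]
  | succ r ih =>
    by_cases h : ∀ e ∈ T, separates S e = false
    · obtain ⟨A, hA, h'⟩ := ih S (by
        have : T.countP (separates S) = 0 := by simpa [List.countP_eq_zero] using h
        omega)
      exact ⟨A, List.mem_flatMap.2 ⟨A, hA, by simp⟩, h'⟩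
    · push Not at h
      obtain ⟨e, he, hSe⟩ := h
      obtain ⟨i, hi, rfl⟩ := List.getElem_of_mem he
      obtain ⟨B, hB, hB₁, hB₂⟩ := hT.exists_fundamentalCut hi
      have hsplit : T = T.take i ++ T[i] :: T.drop (i + 1) := by
        rw [← List.drop_eq_getElem_cons hi, List.take_append_drop]
      have hperm : T.Perm (T[i] :: (T.take i ++ T.drop (i + 1))) := by
        conv_lhs => rw [hsplit]
        exact List.perm_middle
      have hSe : separates S T[i] = true := by simpa using hSe
      have hx : ∀ f, separates (fun v => S v != B.getD v false) f =
          (separates S f != separates (fun v => B.getD v false) f) := by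
        intro f
        simp only [separates]
        cases S f.2.1 <;> cases S f.2.2 <;> cases B.getD f.2.1 false <;>
          cases B.getD f.2.2 false <;> rfl
      obtain ⟨A, hA, h'⟩ := ih (fun v => S v != B.getD v false) (by
        rw [hperm.countP_eq, List.countP_cons_of_pos hSe] at hS
        rw [hperm.countP_eq, List.countP_cons_of_neg (by rw [hx, hSe, hB₁]; simp)]
        refine le_trans (le_of_eq (List.countP_congr fun f hf => ?_)) (Nat.le_of_succ_le_succ hS)
        rw [hx, hB₂ f hf]; simp)
      refine ⟨xorBits n A B, List.mem_flatMap.2 ⟨A, hA, ?_⟩, fun v hv => ?_⟩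
      · exact List.mem_cons_of_mem _ (List.mem_map.2 ⟨B, hX hB, rfl⟩)
      · rw [xorBits_getD _ _ hv, h' v hv]
        cases S v <;> cases B.getD v false <;> rfl

theorem length_of_mem_sums {n : ℕ} {X : List (List Bool)} {r : ℕ} :
    ∀ A ∈ sums n X r, A.length = n := by
  induction r with
  | zero =>
    intro A hA
    simp only [sums, List.mem_cons, List.not_mem_nil, or_false] at hA
    rcases hA with rfl | rfl <;> simp
  | succ r ih =>
    intro A hA
    obtain ⟨B, hB, hA⟩ := List.mem_flatMap.1 hA
    rcases List.mem_cons.1 hA with rfl | hA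
    · exact ih _ hB
    · obtain ⟨C, -, rfl⟩ := List.mem_map.1 hA
      simp [xorBits]

/-- The packing runs on the same edges with load zero. The list built from all trees includes the
fundamental cuts of the one tree that meets the cut of `S` at most 8 times. -/
theorem exists_candidate {n k : ℕ} (hk : 0 < k) {es : List FlaggedEdge}
    (hv : ∀ e ∈ es, e.1 < n ∧ e.2.1 < n)
    (h : ∀ S : ℕ → Bool, (∃ v < n, S v = true) → (∃ v < n, S v = false) →
      k ≤ es.countP fun e => S e.1 != S e.2.1) {S : ℕ → Bool} (h₁ : ∃ v < n, S v = true)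
    (h₂ : ∃ v < n, S v = false) (hS : (es.countP fun e => S e.1 != S e.2.1) ≤ k + 1) :
    ∃ A ∈ candidates n k es, ∀ v < n, A.getD v false = S v := by
  have hn : 0 < n := by obtain ⟨v, hv, -⟩ := h₁; omega
  set fs : List LoadedEdge := es.map fun e => (0, e.1, e.2.1) with hfs
  have hcount (S : ℕ → Bool) : fs.countP (separates S) = es.countP fun e => S e.1 != S e.2.1 := by
    rw [hfs, List.countP_map]; rfl
  have hvf : Valid n fs := by
    intro f hf
    obtain ⟨e, he, rfl⟩ := List.mem_map.1 hf
    exact hv e he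
  have hrob : Robust k (List.range n) fs := by
    intro g hg₁ hg₂
    have := h g (by simpa using hg₁) (by simpa using hg₂)
    rw [← hcount] at this
    refine this.trans_eq (List.countP_congr fun f hf => ?_)
    obtain ⟨h₁, h₂⟩ := hvf f hf
    simp only [separates, range_getD h₁, range_getD h₂]
  have hne : fs ≠ [] := by
    have := h S h₁ h₂
    rw [← hcount] at this
    rintro h₀
    rw [h₀] at this
    simp at this; omega
  obtain ⟨T, hT, hT₁, hT₂⟩ := exists_tree hk hn hrob hvf
    (fun f hf => by obtain ⟨e, -, rfl⟩ := List.mem_map.1 hf; rfl)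
    (l := es.flatMap fun _ => List.replicate k ()) (by simp [hfs, List.length_flatMap, mul_comm])
    (by rw [hcount]; exact hS) hne
  exact hT₁.mem_sums (fun X hX => List.mem_flatMap.2 ⟨T, hT, hX⟩) 8 S hT₂

set_option linter.unusedSectionVars false

/-! ### Crossing sets. -/

section Cross

variable {V : Type*} [Fintype V] [DecidableEq V]

theorem Cross.symm {A B : Finset V} (h : Cross A B) : Cross B A :=
  ⟨by rw [inter_comm]; exact h.1, h.2.2.1, h.2.1, by rw [union_comm]; exact h.2.2.2⟩

theorem Cross.compl_right {A B : Finset V} (h : Cross A B) : Cross A Bᶜ := by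
  obtain ⟨⟨a, ha⟩, ⟨b, hb⟩, ⟨c, hc⟩, ⟨d, hd⟩⟩ := h
  refine ⟨⟨b, ?_⟩, ⟨a, ?_⟩, ⟨d, ?_⟩, ⟨c, ?_⟩⟩ <;> simp_all

theorem Cross.compl_left {A B : Finset V} (h : Cross A B) : Cross Aᶜ B :=
  h.symm.compl_right.symm

end Cross

/-! ### Counting edges between corners. -/

namespace Network

variable {V E : Type*} [Fintype V] [DecidableEq V] [Fintype E] [DecidableEq E]
variable {H : Network V E} {A B C P Q : Finset V} {W : Finset E} {k : ℕ}

/-- The number of edges of `W` in the cut of `A` with both ends in `P`. -/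
def inside (H : Network V E) (W : Finset E) (A P : Finset V) : ℕ :=
  #(W.filter fun e => (H.src e ∈ A ∩ P ∧ H.tgt e ∈ P \ A) ∨ (H.src e ∈ P \ A ∧ H.tgt e ∈ A ∩ P))

/-- The number of edges of `W` in the cut of `A`. -/
def degree (H : Network V E) (W : Finset E) (A : Finset V) : ℕ :=
  #(W.filter fun e => (H.src e ∈ A ∧ H.tgt e ∉ A) ∨ (H.src e ∉ A ∧ H.tgt e ∈ A))

/-- No edge is in both cuts. -/
def Separate (H : Network V E) (A B : Finset V) : Prop :=
  ∀ e, (H.src e ∈ A ↔ H.tgt e ∈ A) ∨ (H.src e ∈ B ↔ H.tgt e ∈ B)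

theorem card_filter_eq_add {ι : Type*} {W : Finset ι} {p q r : ι → Prop} [DecidablePred p]
    [DecidablePred q] [DecidablePred r] (h : ∀ e, p e ↔ q e ∨ r e) (h' : ∀ e, ¬(q e ∧ r e)) :
    #(W.filter p) = #(W.filter q) + #(W.filter r) := by
  classical
  rw [← card_union_of_disjoint (disjoint_filter.2 fun e _ h₁ h₂ => h' e ⟨h₁, h₂⟩), ← filter_or]
  simp only [h]

theorem mem_cut {e : E} : e ∈ H.cut A ↔
    (H.src e ∈ A ∧ H.tgt e ∉ A) ∨ (H.src e ∉ A ∧ H.tgt e ∈ A) := by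
  simp [cut, between]

theorem card_cut_inter : #(H.cut A ∩ W) = H.degree W A := by
  rw [degree]; congr 1; ext e
  rw [mem_inter, mem_cut, mem_filter, and_comm]

theorem card_cut : #(H.cut A) = H.degree univ A := by rw [← card_cut_inter, inter_univ]

theorem degree_compl : H.degree W Aᶜ = H.degree W A := by
  unfold degree; congr 1; ext e; simp only [mem_filter, mem_compl]; tauto

theorem cut_compl : H.cut Aᶜ = H.cut A := by
  ext e; simp only [mem_cut, mem_compl]; tauto

theorem inside_compl : H.inside W Aᶜ P = H.inside W A P := by
  unfold inside; congr 1; ext e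
  simp only [mem_filter, mem_inter, mem_sdiff, mem_compl]; tauto

theorem weight_side : H.weight (A ∩ B) (B \ A) = H.inside H.U A B := by
  rw [weight, inside]; congr 1; ext e
  simp only [between, mem_inter, mem_filter, mem_univ, true_and]; tauto

theorem weight_side' : H.weight (A \ B) (A ∪ B)ᶜ = H.inside H.U A Bᶜ := by
  rw [weight, inside]; congr 1; ext e
  simp only [between, mem_inter, mem_filter, mem_univ, true_and, mem_sdiff, mem_compl, mem_union]
  tauto

theorem hasRedSide_iff :
    H.HasRedSide A B ↔ 2 ≤ H.inside H.U A B ∨ 2 ≤ H.inside H.U A Bᶜ := by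
  rw [HasRedSide, weight_side, weight_side']

theorem hasRedSide_compl_left : H.HasRedSide Aᶜ B ↔ H.HasRedSide A B := by
  rw [hasRedSide_iff, hasRedSide_iff, inside_compl, inside_compl]

theorem inside_mono {W' : Finset E} (h : W ⊆ W') : H.inside W A P ≤ H.inside W' A P :=
  card_le_card (filter_subset_filter _ h)

theorem exists_of_inside_pos (h : 1 ≤ H.inside W A P) :
    (∃ v, v ∈ A ∧ v ∈ P) ∧ ∃ v, v ∉ A ∧ v ∈ P := by
  obtain ⟨e, he⟩ := card_pos.1 h
  simp only [mem_filter, mem_inter, mem_sdiff] at he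
  rcases he.2 with h | h
  · exact ⟨⟨_, h.1⟩, _, h.2.2, h.2.1⟩
  · exact ⟨⟨_, h.2⟩, _, h.1.2, h.1.1⟩

theorem Separate.symm (h : H.Separate A B) : H.Separate B A := fun e => (h e).symm

theorem Separate.compl_right (h : H.Separate A B) : H.Separate A Bᶜ := fun e => by
  have := h e; simp only [mem_compl]; tauto

theorem Separate.compl_left (h : H.Separate A B) : H.Separate Aᶜ B := h.symm.compl_right.symm

/-- Without edges joining opposite corners, a cut is the disjoint union of its two sides. -/
theorem Separate.degree_eq (h : H.Separate A B) :
    H.degree W A = H.inside W A B + H.inside W A Bᶜ := by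
  refine card_filter_eq_add (fun e => ?_) fun e => ?_ <;>
  · have := h e
    simp only [mem_inter, mem_sdiff, mem_compl]; tauto

theorem Separate.degree_inter (h : H.Separate A B) :
    H.degree W (A ∩ B) = H.inside W A B + H.inside W B A := by
  refine card_filter_eq_add (fun e => ?_) fun e => ?_ <;>
  · have := h e
    simp only [mem_inter, mem_sdiff]; tauto

theorem Separate.degree_symmDiff (h : H.Separate A B) :
    H.degree W ((A \ B) ∪ (B \ A)) = H.degree W A + H.degree W B := by
  refine card_filter_eq_add (fun e => ?_) fun e => ?_ <;>
  · have := h e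
    grind [mem_compl]

theorem Separate.inside_eq (h : H.Separate A C) :
    H.inside W A P = H.inside W A (P ∩ C) + H.inside W A (P ∩ Cᶜ) := by
  refine card_filter_eq_add (fun e => ?_) fun e => ?_ <;>
  · have := h e
    grind [mem_compl]

/-- The edges of the cut of `B` inside `A` when they are not in the cut of `C`. -/
theorem Separate.inside_eq_of_inter (h : H.Separate (A ∩ B) C) :
    H.inside W B A = H.inside W B (A ∩ C) + H.inside W B (A ∩ Cᶜ) := by
  refine card_filter_eq_add (fun e => ?_) fun e => ?_ <;>
  · have := h e
    grind [mem_compl]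

theorem Separate.inside_inter (h : H.Separate A B) :
    H.inside W (A ∩ B) C = H.inside W A (B ∩ C) + H.inside W B (A ∩ C) := by
  refine card_filter_eq_add (fun e => ?_) fun e => ?_ <;>
  · have := h e
    grind [mem_compl]

/-- A cell of the cube meets one class of parallel edges in each of the three directions. -/
theorem degree_cell (h : H.Separate A B) (h₁ : H.Separate A C) (h₂ : H.Separate B C) :
    H.degree W (A ∩ B ∩ C) =
      H.inside W A (B ∩ C) + H.inside W B (A ∩ C) + H.inside W C (A ∩ B) := by
  have h₃ : H.Separate (A ∩ B) C := fun e => by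
    have := h₁ e; have := h₂ e; simp only [mem_inter]; tauto
  rw [h₃.degree_inter, h.inside_inter]

/-- The number of edges of `W` in both cuts that join opposite corners. -/
def diagonal (H : Network V E) (W : Finset E) (A B : Finset V) : ℕ :=
  #(W.filter fun e => (H.src e ∈ A ∩ B ∧ H.tgt e ∉ A ∪ B) ∨ (H.src e ∉ A ∪ B ∧ H.tgt e ∈ A ∩ B))

theorem degree_eq_diagonal : H.degree W A = H.inside W A B + H.inside W A Bᶜ +
    (H.diagonal W A B + H.diagonal W A Bᶜ) := by
  simp only [degree, inside, diagonal, card_filter, ← sum_add_distrib]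
  refine sum_congr rfl fun e _ => ?_
  by_cases h₁ : H.src e ∈ A <;> by_cases h₂ : H.tgt e ∈ A <;> by_cases h₃ : H.src e ∈ B <;>
    by_cases h₄ : H.tgt e ∈ B <;> simp [h₁, h₂, h₃, h₄]

theorem degree_inter_diagonal :
    H.degree W (A ∩ B) = H.inside W A B + H.inside W B A + H.diagonal W A B := by
  simp only [degree, inside, diagonal, card_filter, ← sum_add_distrib]
  refine sum_congr rfl fun e _ => ?_
  by_cases h₁ : H.src e ∈ A <;> by_cases h₂ : H.tgt e ∈ A <;> by_cases h₃ : H.src e ∈ B <;>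
    by_cases h₄ : H.tgt e ∈ B <;> simp [h₁, h₂, h₃, h₄]

theorem diagonal_comm : H.diagonal W A B = H.diagonal W B A := by
  unfold diagonal; congr 1; ext e; simp only [mem_filter, mem_inter, mem_union]; tauto

theorem diagonal_compl : H.diagonal W Aᶜ Bᶜ = H.diagonal W A B := by
  unfold diagonal; congr 1; ext e; simp only [mem_filter, mem_inter, mem_union, mem_compl]; tauto

theorem diagonal_compl_left : H.diagonal W Aᶜ B = H.diagonal W A Bᶜ := by
  rw [← diagonal_compl, compl_compl]

/-- With only `k` edges in the cut, the alternative of k+1 edges fails, so all `k` of them are safe.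
-/
theorem FlexConnected.degree_cases (h : H.FlexConnected k 1) {S : Finset V} (h₁ : S.Nonempty)
    (h₂ : Sᶜ.Nonempty) : k ≤ H.degree univ S ∧
      (H.degree univ S = k → H.degree H.U S = 0) := by
  have h₃ := h S h₁ (by rintro rfl; simp at h₂)
  have h₄ := card_sdiff_add_card_inter (H.cut S) H.U
  rw [card_cut_inter] at h₄
  rw [card_cut] at h₃ h₄
  omega

theorem mem_tightCuts : A ∈ H.tightCuts k 2 ↔
    A.Nonempty ∧ Aᶜ.Nonempty ∧ H.degree univ A = k + 1 ∧ 2 ≤ H.degree H.U A := by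
  have hne : Aᶜ.Nonempty ↔ A ≠ univ := by rw [nonempty_iff_ne_empty, Ne, compl_eq_empty_iff]
  rw [hne, ← card_cut, ← card_cut_inter]
  constructor
  · rintro ⟨h₁, h₂, h₃, h₄⟩; exact ⟨h₁, h₂, by omega, h₄⟩
  · rintro ⟨h₁, h₂, h₃, h₄⟩; exact ⟨h₁, h₂, by omega, h₄⟩

theorem compl_mem_tightCuts (h : A ∈ H.tightCuts k 2) : Aᶜ ∈ H.tightCuts k 2 := by
  rw [mem_tightCuts] at h ⊢
  rw [degree_compl, degree_compl, compl_compl]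
  exact ⟨h.2.1, h.1, h.2.2⟩

/-! ### Squares and cubes of tight cuts. -/

/-- Here k = 2j+1; `a`, `b` count the sides of the two cuts, `d`, `d'` the diagonals, and `u`, `v`,
`w`, `w'` the corresponding unsafe edges. Adjacent corners are not both of degree k by `hA'`, `hB'`,
so one opposite pair has degrees exactly 2j+2. This forces, say, b₁ = a₂ and b₂ = a₁, and the other
corners have even degrees 2a₁ and 2a₂, hence a₁, a₂ ≥ j+1. -/
theorem square_arith {j a₁ a₂ b₁ b₂ d d' u₁ u₂ v₁ v₂ w w' : ℕ}
    (hA : a₁ + a₂ + (d + d') = 2 * j + 2) (hB : b₁ + b₂ + (d + d') = 2 * j + 2)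
    (hA' : 2 ≤ u₁ + u₂ + (w + w')) (hB' : 2 ≤ v₁ + v₂ + (w + w'))
    (c₁ : 2 * j + 1 ≤ a₁ + b₁ + d ∧ (a₁ + b₁ + d = 2 * j + 1 → u₁ + v₁ + w = 0))
    (c₂ : 2 * j + 1 ≤ a₂ + b₁ + d' ∧ (a₂ + b₁ + d' = 2 * j + 1 → u₂ + v₁ + w' = 0))
    (c₃ : 2 * j + 1 ≤ b₂ + a₁ + d' ∧ (b₂ + a₁ + d' = 2 * j + 1 → v₂ + u₁ + w' = 0))
    (c₄ : 2 * j + 1 ≤ a₂ + b₂ + d ∧ (a₂ + b₂ + d = 2 * j + 1 → u₂ + v₂ + w = 0)) :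
    d = 0 ∧ d' = 0 ∧ a₁ = j + 1 ∧ a₂ = j + 1 ∧ b₁ = j + 1 ∧ b₂ = j + 1 := by
  by_cases h₁ : a₁ + b₁ + d = 2 * j + 1 <;> by_cases h₂ : a₂ + b₁ + d' = 2 * j + 1 <;>
    by_cases h₃ : b₂ + a₁ + d' = 2 * j + 1 <;> by_cases h₄ : a₂ + b₂ + d = 2 * j + 1 <;>
    simp only [h₁, h₂, h₃, h₄, true_implies, false_implies, and_true, le_refl] at c₁ c₂ c₃ c₄ <;>
    omega

/-- The four degrees sum to 6q = 3k+3 and are each at least k, while n₁, n₂ ≥ 1 gives q ≥ 2. So k =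
3 with equality throughout, and every u vanishes. -/
theorem cube_arith {k q n₁ n₂ n₃ n₄ m₁ m₂ p₁ p₂ u₁ u₂ u₃ u₄ v₁ v₂ w₁ w₂ : ℕ}
    (hk : 2 * q = k + 1) (h₁ : n₁ + n₃ = q) (h₂ : n₂ + n₄ = q) (h₃ : n₁ + n₂ = q)
    (h₄ : m₁ + m₂ = q) (h₅ : p₁ + p₂ = q) (hn₁ : 1 ≤ n₁) (hn₂ : 1 ≤ n₂)
    (hu : 2 ≤ u₁ + u₂ + u₃ + u₄)
    (c₁ : k ≤ n₁ + m₁ + p₁ ∧ (n₁ + m₁ + p₁ = k → u₁ + v₁ + w₁ = 0))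
    (c₂ : k ≤ n₂ + m₁ + p₂ ∧ (n₂ + m₁ + p₂ = k → u₂ + v₁ + w₂ = 0))
    (c₃ : k ≤ n₃ + m₂ + p₁ ∧ (n₃ + m₂ + p₁ = k → u₃ + v₂ + w₁ = 0))
    (c₄ : k ≤ n₄ + m₂ + p₂ ∧ (n₄ + m₂ + p₂ = k → u₄ + v₂ + w₂ = 0)) : False := by
  obtain ⟨c₁, c₁'⟩ := c₁
  obtain ⟨c₂, c₂'⟩ := c₂
  obtain ⟨c₃, c₃'⟩ := c₃
  obtain ⟨c₄, c₄'⟩ := c₄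
  have := c₁' (by omega)
  have := c₂' (by omega)
  have := c₃' (by omega)
  have := c₄' (by omega)
  omega

/-- Crossing tight cuts have no edge in common, and their side edges are of equal size. -/
theorem FlexConnected.square (h : H.FlexConnected k 1) (hk : Odd k) (hA : A ∈ H.tightCuts k 2)
    (hB : B ∈ H.tightCuts k 2) (hAB : Cross A B) :
    H.Separate A B ∧ 2 * H.inside univ A B = k + 1 ∧ 2 * H.inside univ A Bᶜ = k + 1 ∧
      2 * H.inside univ B A = k + 1 ∧ 2 * H.inside univ B Aᶜ = k + 1 := by
  obtain ⟨-, -, hA₁, hA₂⟩ := mem_tightCuts.1 hA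
  obtain ⟨-, -, hB₁, hB₂⟩ := mem_tightCuts.1 hB
  obtain ⟨h₁, h₂, h₃, h₄⟩ := hAB
  have e₁ (W : Finset E) := degree_eq_diagonal (H := H) (W := W) (A := A) (B := B)
  have e₂ (W : Finset E) := degree_eq_diagonal (H := H) (W := W) (A := B) (B := A)
  have e₃ (W : Finset E) := degree_inter_diagonal (H := H) (W := W) (A := A) (B := B)
  have e₄ (W : Finset E) := degree_inter_diagonal (H := H) (W := W) (A := A) (B := Bᶜ)
  have e₅ (W : Finset E) := degree_inter_diagonal (H := H) (W := W) (A := B) (B := Aᶜ)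
  have e₆ (W : Finset E) := degree_inter_diagonal (H := H) (W := W) (A := Aᶜ) (B := Bᶜ)
  simp only [inside_compl, diagonal_comm (A := B), diagonal_compl_left, compl_compl]
    at e₁ e₂ e₃ e₄ e₅ e₆
  rw [sdiff_eq_inter_compl] at h₂ h₃
  rw [compl_union] at h₄
  have c₁ := h.degree_cases h₁ (by
    rw [compl_inter]; exact h₄.mono (inter_subset_left.trans subset_union_left))
  have c₂ := h.degree_cases h₂ (by
    rw [compl_inter]; exact h₄.mono (inter_subset_left.trans subset_union_left))
  have c₃ := h.degree_cases h₃ (by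
    rw [compl_inter]; exact h₄.mono (inter_subset_right.trans subset_union_left))
  have c₄ := h.degree_cases h₄ (by
    rw [compl_inter, compl_compl]; exact h₁.mono (inter_subset_left.trans subset_union_left))
  obtain ⟨j, rfl⟩ := hk
  rw [e₁] at hA₁ hA₂
  rw [e₂] at hB₁ hB₂
  rw [e₃, e₃] at c₁
  rw [e₄, e₄] at c₂
  rw [e₅, e₅] at c₃
  rw [e₆, e₆] at c₄
  obtain ⟨z₁, z₂, r₁, r₂, r₃, r₄⟩ := square_arith hA₁ hB₁ hA₂ hB₂ c₁ c₂ c₃ c₄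
  refine ⟨fun e => ?_, by rw [r₁]; ring, by rw [r₂]; ring, by rw [r₃]; ring, by rw [r₄]; ring⟩
  have k₁ := card_eq_zero.1 z₁
  have k₂ := card_eq_zero.1 z₂
  have k₃ := filter_eq_empty_iff.1 k₁ (mem_univ e)
  have k₄ := filter_eq_empty_iff.1 k₂ (mem_univ e)
  simp only [mem_inter, mem_union, mem_compl] at k₃ k₄
  clear * - k₃ k₄
  tauto

/-- Three tight cuts do not form a cube. -/
theorem FlexConnected.not_cube (h : H.FlexConnected k 1) (hk : Odd k) (hA : A ∈ H.tightCuts k 2)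
    (hB : B ∈ H.tightCuts k 2) (hC : C ∈ H.tightCuts k 2) (hAB : Cross A B) (hAC : Cross A C)
    (h₁ : 1 ≤ H.inside univ A (B ∩ C)) (h₂ : 1 ≤ H.inside univ A (Bᶜ ∩ C)) : False := by
  obtain ⟨sAB, q₁, q₂, q₃, q₄⟩ := h.square hk hA hB hAB
  obtain ⟨sAC, r₁, r₂, r₃, r₄⟩ := h.square hk hA hC hAC
  have half : ∀ x : ℕ, 2 * x = k + 1 → x = H.inside univ A B := by clear * - q₁; omega
  have n₁ := sAC.inside_eq (W := univ) (P := B)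
  have n₂ := sAC.inside_eq (W := univ) (P := Bᶜ)
  have n₃ := sAB.inside_eq (W := univ) (P := C)
  rw [inter_comm C, inter_comm C] at n₃
  -- All sides have q edges, so opposite cells of the square of B and C hold equally many edges of
  -- the cut of A. Thus all four cells hold one, and its ends give vertices in all eight cells of
  -- the cube.
  have h₃ : 1 ≤ H.inside univ A (B ∩ Cᶜ) := by omega
  have h₄ : 1 ≤ H.inside univ A (Bᶜ ∩ Cᶜ) := by omega
  obtain ⟨⟨a₁, p₁, p₁'⟩, ⟨b₁, s₁, s₁'⟩⟩ := exists_of_inside_pos h₁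
  obtain ⟨⟨a₂, p₂, p₂'⟩, ⟨b₂, s₂, s₂'⟩⟩ := exists_of_inside_pos h₂
  obtain ⟨⟨a₃, p₃, p₃'⟩, ⟨b₃, s₃, s₃'⟩⟩ := exists_of_inside_pos h₃
  obtain ⟨⟨a₄, p₄, p₄'⟩, ⟨b₄, s₄, s₄'⟩⟩ := exists_of_inside_pos h₄
  simp only [mem_inter, mem_compl] at p₁' p₂' p₃' p₄' s₁' s₂' s₃' s₄'
  have hBC : Cross B C :=
    ⟨⟨a₁, by simp [p₁']⟩, ⟨a₃, by simp [p₃']⟩, ⟨a₂, by simp [p₂']⟩, ⟨a₄, by simp [p₄']⟩⟩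
  obtain ⟨sBC, t₁, t₂, t₃, t₄⟩ := h.square hk hB hC hBC
  have d₁ (W : Finset E) := degree_cell (W := W) sAB sAC sBC
  have d₂ (W : Finset E) := degree_cell (W := W) sAB.compl_right sAC sBC.compl_left
  have d₃ (W : Finset E) := degree_cell (W := W) sAB sAC.compl_right sBC.compl_right
  have d₄ (W : Finset E) := degree_cell (W := W) sAB.compl_right sAC.compl_right
    sBC.compl_left.compl_right
  simp only [inside_compl] at d₁ d₂ d₃ d₄
  have m₁ := sBC.inside_eq (W := univ) (P := A)
  have m₂ := sBC.symm.inside_eq (W := univ) (P := A)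
  have u₁ := sAB.degree_eq (W := H.U)
  have u₂ := sAC.inside_eq (W := H.U) (P := B)
  have u₃ := sAC.inside_eq (W := H.U) (P := Bᶜ)
  have c₁ := h.degree_cases (S := A ∩ B ∩ C) ⟨a₁, by simp [p₁, p₁']⟩ ⟨b₁, by simp [s₁]⟩
  have c₂ := h.degree_cases (S := A ∩ Bᶜ ∩ C) ⟨a₂, by simp [p₂, p₂']⟩ ⟨b₁, by simp [s₁]⟩
  have c₃ := h.degree_cases (S := A ∩ B ∩ Cᶜ) ⟨a₃, by simp [p₃, p₃']⟩ ⟨b₁, by simp [s₁]⟩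
  have c₄ := h.degree_cases (S := A ∩ Bᶜ ∩ Cᶜ) ⟨a₄, by simp [p₄, p₄']⟩ ⟨b₁, by simp [s₁]⟩
  have hU := (mem_tightCuts.1 hA).2.2.2
  rw [u₁, u₂, u₃] at hU
  rw [d₁, d₁] at c₁
  rw [d₂, d₂] at c₂
  rw [d₃, d₃] at c₃
  rw [d₄, d₄] at c₄
  exact cube_arith q₁ n₁.symm (n₂.symm.trans (half _ q₂)) (n₃.symm.trans (half _ r₁))
    (m₁.symm.trans (half _ q₃)) (m₂.symm.trans (half _ r₃)) h₁ h₂ (hU.trans_eq (by ring)) c₁ c₂ c₃ c₄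

/-- A tight cut that crosses a corner does not divide the adjacent side edge. -/
theorem FlexConnected.not_divides (h : H.FlexConnected k 1) (hk : Odd k)
    (hA : A ∈ H.tightCuts k 2) (hB : B ∈ H.tightCuts k 2) (hC : C ∈ H.tightCuts k 2)
    (hAB : Cross A B) (hI : A ∩ B ∈ H.tightCuts k 2) (hIC : Cross (A ∩ B) C)
    (h₁ : 1 ≤ H.inside univ B (A ∩ C)) (h₂ : 1 ≤ H.inside univ B (A ∩ Cᶜ)) : False := by
  obtain ⟨sAB, q₁, q₂, q₃, q₄⟩ := h.square hk hA hB hAB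
  obtain ⟨sIC, r₁, r₂, r₃, r₄⟩ := h.square hk hI hC hIC
  have m := sIC.inside_eq_of_inter (W := univ)
  have n₁ := sAB.inside_inter (W := univ) (C := C)
  have n₂ := sAB.inside_inter (W := univ) (C := Cᶜ)
  have h₃ : 1 ≤ H.inside univ A (B ∩ C) := by omega
  have h₄ : 1 ≤ H.inside univ A (B ∩ Cᶜ) := by omega
  obtain ⟨⟨a₁, p₁, p₁'⟩, ⟨b₁, s₁, s₁'⟩⟩ := exists_of_inside_pos h₁
  obtain ⟨⟨a₂, p₂, p₂'⟩, ⟨b₂, s₂, s₂'⟩⟩ := exists_of_inside_pos h₂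
  obtain ⟨⟨a₃, p₃, p₃'⟩, ⟨b₃, s₃, s₃'⟩⟩ := exists_of_inside_pos h₃
  obtain ⟨⟨a₄, p₄, p₄'⟩, ⟨b₄, s₄, s₄'⟩⟩ := exists_of_inside_pos h₄
  simp only [mem_inter, mem_compl] at p₁' p₂' p₃' p₄' s₁' s₂' s₃' s₄'
  -- The ends of the two given edges already occupy the four corners of B and C, so B, C and A form
  -- a cube seen from B.
  have hBC : Cross B C :=
    ⟨⟨a₁, by simp [p₁, p₁']⟩, ⟨a₂, by simp [p₂, p₂']⟩, ⟨b₁, by simp [s₁, s₁']⟩,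
      ⟨b₂, by simp [s₂, s₂']⟩⟩
  rw [inter_comm] at h₁ h₂
  exact h.not_cube hk hB hC hA hBC hAB.symm h₁ h₂

/-- Two sides of q edges each bound the corner, so only the number of unsafe edges has to be
checked. -/
theorem FlexConnected.inter_mem (h : H.FlexConnected k 1) (hk : Odd k)
    (hA : A ∈ H.tightCuts k 2) (hB : B ∈ H.tightCuts k 2) (hAB : Cross A B)
    (hU : 2 ≤ H.inside H.U A B + H.inside H.U B A) : A ∩ B ∈ H.tightCuts k 2 := by
  obtain ⟨sAB, q₁, q₂, q₃, q₄⟩ := h.square hk hA hB hAB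
  have e₁ := sAB.degree_inter (W := univ)
  have e₂ := sAB.degree_inter (W := H.U)
  exact mem_tightCuts.2 ⟨hAB.1, hAB.2.2.2.mono (by
    rw [compl_subset_compl]; exact inter_subset_left.trans subset_union_left), by omega, by omega⟩

/-! ### The red and the blue family. -/

variable (H k) in
/-- The tight cuts that have a red side edge with all tight cuts that cross them. -/
def redFamily : Set (Finset V) :=
  {A | A ∈ H.tightCuts k 2 ∧ ∀ B ∈ H.tightCuts k 2, Cross A B → H.HasRedSide A B}

variable (H k) in
/-- The tight cuts with two not-safe edges that have no red side edge with any tight cut that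
crosses them. -/
def blueFamily : Set (Finset V) :=
  {A | A ∈ H.tightCuts k 2 ∧ #(H.cut A ∩ H.U) = 2 ∧
    ∀ B ∈ H.tightCuts k 2, Cross A B → ¬H.HasRedSide A B}

theorem symmetric_redFamily : SymmetricFamily (H.redFamily k) := fun A hA =>
  ⟨compl_mem_tightCuts hA.1, fun B hB hAB => hasRedSide_compl_left.2
    (hA.2 B hB (by simpa using hAB.compl_left))⟩

theorem symmetric_blueFamily : SymmetricFamily (H.blueFamily k) := fun A hA =>
  ⟨compl_mem_tightCuts hA.1, by rw [cut_compl]; exact hA.2.1, fun B hB hAB hr =>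
    hA.2.2 B hB (by simpa using hAB.compl_left) (hasRedSide_compl_left.1 hr)⟩

theorem FlexConnected.inside_eq_one (h : H.FlexConnected k 1) (hk : Odd k)
    (hA : A ∈ H.tightCuts k 2) (hB : B ∈ H.tightCuts k 2) (hAB : Cross A B)
    (hr : ¬H.HasRedSide A B) : H.inside H.U A B = 1 ∧ H.inside H.U A Bᶜ = 1 := by
  have e := (h.square hk hA hB hAB).1.degree_eq (W := H.U)
  have := (mem_tightCuts.1 hA).2.2.2
  rw [hasRedSide_iff] at hr
  omega

theorem FlexConnected.twoBlueSides (h : H.FlexConnected k 1) (hk : Odd k)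
    (hA : A ∈ H.tightCuts k 2) (hB : B ∈ H.tightCuts k 2) (hAB : Cross A B)
    (hr : ¬H.HasRedSide A B) : H.TwoBlueSides A B := by
  refine ⟨?_, by rw [weight_side, (h.inside_eq_one hk hA hB hAB hr).1],
    by rw [weight_side', (h.inside_eq_one hk hA hB hAB hr).2]⟩
  ext e
  have := (h.square hk hA hB hAB).1 e
  simp only [mem_cut, between, mem_union, mem_filter, mem_univ, true_and, mem_inter, mem_sdiff,
    mem_compl]
  tauto

/-- The cut of A has one unsafe edge on either side of B. If some D contained both, the side of A
inside D would be divided by B. -/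
theorem FlexConnected.not_red_of_not_red (h : H.FlexConnected k 1) (hk : Odd k)
    (hA : A ∈ H.tightCuts k 2) (hB : B ∈ H.tightCuts k 2) (hC : C ∈ H.tightCuts k 2)
    (hAB : Cross A B) (hAC : Cross A C) (hr : ¬H.HasRedSide A B) : ¬H.HasRedSide A C := by
  obtain ⟨b₁, b₂⟩ := h.inside_eq_one hk hA hB hAB hr
  have key : ∀ D ∈ H.tightCuts k 2, Cross A D → 2 ≤ H.inside H.U A D → False := by
    intro D hD hAD h₂
    have sAB := (h.square hk hA hB hAB).1
    have sAD := (h.square hk hA hD hAD).1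
    have e₁ := sAB.degree_eq (W := H.U)
    have e₂ := sAD.degree_eq (W := H.U)
    have e₃ := sAD.inside_eq (W := H.U) (P := B)
    have e₄ := sAD.inside_eq (W := H.U) (P := Bᶜ)
    have e₅ := sAB.inside_eq (W := H.U) (P := D)
    rw [inter_comm D, inter_comm D] at e₅
    have i₁ := inside_mono (H := H) (A := A) (P := B ∩ D) (subset_univ H.U)
    have i₂ := inside_mono (H := H) (A := A) (P := Bᶜ ∩ D) (subset_univ H.U)
    exact h.not_cube hk hA hB hD hAB hAD (by omega) (by omega)
  rw [hasRedSide_iff]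
  rintro (h₁ | h₁)
  · exact key C hC hAC h₁
  · exact key Cᶜ (compl_mem_tightCuts hC) hAC.compl_right h₁

theorem FlexConnected.union_families (h : H.FlexConnected k 1) (hk : Odd k) :
    H.redFamily k ∪ H.blueFamily k = H.tightCuts k 2 := by
  ext A
  refine ⟨fun hA => hA.elim (·.1) (·.1), fun hA => ?_⟩
  by_cases hall : ∀ B ∈ H.tightCuts k 2, Cross A B → H.HasRedSide A B
  · exact .inl ⟨hA, hall⟩
  · push Not at hall
    obtain ⟨B, hB, hAB, hr⟩ := hall
    refine .inr ⟨hA, ?_, fun C hC hAC => h.not_red_of_not_red hk hA hB hC hAB hAC hr⟩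
    obtain ⟨b₁, b₂⟩ := h.inside_eq_one hk hA hB hAB hr
    rw [card_cut_inter, (h.square hk hA hB hAB).1.degree_eq, b₁, b₂]

/-- A crossing C without a red side would leave one unsafe edge of the corner on either side of C.
The red side of δ(B) has at least two, so C would divide it. -/
theorem FlexConnected.inter_mem_redFamily (h : H.FlexConnected k 1) (hk : Odd k)
    (hA : A ∈ H.tightCuts k 2) (hB : B ∈ H.tightCuts k 2) (hAB : Cross A B)
    (hr : 2 ≤ H.inside H.U B A) : A ∩ B ∈ H.redFamily k := by
  have hI := h.inter_mem hk hA hB hAB (by omega)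
  refine ⟨hI, fun C hC hIC => ?_⟩
  by_contra hn
  obtain ⟨b₁, b₂⟩ := h.inside_eq_one hk hI hC hIC hn
  have sAB := (h.square hk hA hB hAB).1
  have sIC := (h.square hk hI hC hIC).1
  have e₁ := sAB.inside_inter (W := H.U) (C := C)
  have e₂ := sAB.inside_inter (W := H.U) (C := Cᶜ)
  have e₃ := sIC.inside_eq_of_inter (W := H.U)
  have i₁ := inside_mono (H := H) (A := B) (P := A ∩ C) (subset_univ H.U)
  have i₂ := inside_mono (H := H) (A := B) (P := A ∩ Cᶜ) (subset_univ H.U)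
  exact h.not_divides hk hA hB hC hAB hI hIC (by omega) (by omega)

/-- The corner has one unsafe edge from δ(A) and one from δ(B). If C contained both, the q edges of
δ(A ∩ B) inside C would include one from δ(A), so not all q edges of δ(B) inside A would lie in C,
and C would divide that side. -/
theorem FlexConnected.inter_mem_blueFamily (h : H.FlexConnected k 1) (hk : Odd k)
    (hA : A ∈ H.blueFamily k) (hB : B ∈ H.blueFamily k) (hAB : Cross A B) :
    A ∩ B ∈ H.blueFamily k := by
  obtain ⟨a₁, a₂⟩ := h.inside_eq_one hk hA.1 hB.1 hAB (hA.2.2 B hB.1 hAB)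
  obtain ⟨b₁, b₂⟩ := h.inside_eq_one hk hB.1 hA.1 hAB.symm (hB.2.2 A hA.1 hAB.symm)
  have hI := h.inter_mem hk hA.1 hB.1 hAB (by omega)
  obtain ⟨sAB, q₁, q₂, q₃, q₄⟩ := h.square hk hA.1 hB.1 hAB
  have key : ∀ C ∈ H.tightCuts k 2, Cross (A ∩ B) C → 2 ≤ H.inside H.U (A ∩ B) C → False := by
    intro C hC hIC h₂
    obtain ⟨sIC, r₁, r₂, r₃, r₄⟩ := h.square hk hI hC hIC
    have e₁ := sAB.inside_inter (W := H.U) (C := C)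
    have e₂ := sAB.inside_inter (W := univ) (C := C)
    have e₃ := sIC.inside_eq_of_inter (W := H.U)
    have e₄ := sIC.inside_eq_of_inter (W := univ)
    have e₅ := (show H.Separate (B ∩ A) C by rwa [inter_comm]).inside_eq_of_inter (W := H.U)
    have i₁ := inside_mono (H := H) (A := B) (P := A ∩ C) (subset_univ H.U)
    have i₂ := inside_mono (H := H) (A := A) (P := B ∩ C) (subset_univ H.U)
    exact h.not_divides hk hA.1 hB.1 hC hAB hI hIC (by omega) (by omega)
  refine ⟨hI, by rw [card_cut_inter, sAB.degree_inter, a₁, b₁], fun C hC hIC => ?_⟩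
  rw [hasRedSide_iff]
  rintro (h₁ | h₁)
  · exact key C hC hIC h₁
  · exact key Cᶜ (compl_mem_tightCuts hC) hIC.compl_right h₁

theorem FlexConnected.properCrossing_blueFamily (h : H.FlexConnected k 1) (hk : Odd k) :
    ProperCrossingFamily (H.blueFamily k) := by
  refine ⟨fun A hA B hB hAB => ⟨h.inter_mem_blueFamily hk hA hB hAB, ?_⟩, fun A hA B hB hAB hd => ?_⟩
  · have := h.inter_mem_blueFamily hk (symmetric_blueFamily A hA) (symmetric_blueFamily B hB)
      hAB.compl_left.compl_right
    simpa using symmetric_blueFamily _ this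
  -- The two cuts are disjoint, so the symmetric difference has 2k+2 cut edges.
  · have e := (h.square hk hA.1 hB.1 hAB).1.degree_symmDiff (W := univ)
    have h₁ := (mem_tightCuts.1 hA.1).2.2.1
    have h₂ := (mem_tightCuts.1 hB.1).2.2.1
    have h₃ := (mem_tightCuts.1 hd.1).2.2.1
    omega

theorem FlexConnected.uncrossable_redFamily (h : H.FlexConnected k 1) (hk : Odd k) :
    Uncrossable (H.redFamily k) := by
  intro A hA B hB
  by_cases hAB : Cross A B
  · have hA' := compl_mem_tightCuts hA.1
    have hB' := compl_mem_tightCuts hB.1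
    have hu : Aᶜ ∩ Bᶜ ∈ H.redFamily k → A ∪ B ∈ H.redFamily k := fun hm => by
      simpa using symmetric_redFamily _ hm
    have hr₁ := hasRedSide_iff.1 (hA.2 B hB.1 hAB)
    have hr₂ := hasRedSide_iff.1 (hB.2 A hA.1 hAB.symm)
    rw [sdiff_eq_inter_compl, sdiff_eq_inter_compl]
    -- Both end corners of a red side are in the family. A red side of A and one of B share one
    -- corner, and their other two ends are opposite corners.
    rcases hr₁ with h₁ | h₁ <;> rcases hr₂ with h₂ | h₂
    · exact .inr ⟨h.inter_mem_redFamily hk hA.1 hB' hAB.compl_right (by rwa [inside_compl]),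
        h.inter_mem_redFamily hk hB.1 hA' hAB.symm.compl_right (by rwa [inside_compl])⟩
    · refine .inl ⟨?_, hu (h.inter_mem_redFamily hk hA' hB' hAB.compl_left.compl_right
        (by rwa [inside_compl]))⟩
      rw [inter_comm]
      exact h.inter_mem_redFamily hk hB.1 hA.1 hAB.symm h₁
    · refine .inl ⟨h.inter_mem_redFamily hk hA.1 hB.1 hAB h₂, hu ?_⟩
      rw [inter_comm]
      exact h.inter_mem_redFamily hk hB' hA' hAB.symm.compl_left.compl_right (by rwa [inside_compl])
    · refine .inr ⟨?_, ?_⟩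
      · rw [inter_comm]
        exact h.inter_mem_redFamily hk hB' hA.1 hAB.symm.compl_left h₁
      · rw [inter_comm]
        exact h.inter_mem_redFamily hk hA' hB.1 hAB.compl_left h₂
  · simp only [Cross, not_and_or, not_nonempty_iff_eq_empty] at hAB
    rcases hAB with h₀ | h₀ | h₀ | h₀
    · have hd := disjoint_iff_inter_eq_empty.2 h₀
      rw [sdiff_eq_self_of_disjoint hd, sdiff_eq_self_of_disjoint hd.symm]
      exact .inr ⟨hA, hB⟩
    · have hs := sdiff_eq_empty_iff_subset.1 h₀
      rw [inter_eq_left.2 hs, union_eq_right.2 hs]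
      exact .inl ⟨hA, hB⟩
    · have hs := sdiff_eq_empty_iff_subset.1 h₀
      rw [inter_eq_right.2 hs, union_eq_left.2 hs]
      exact .inl ⟨hB, hA⟩
    · have hu : ∀ v, v ∈ A ∨ v ∈ B := fun v => by
        by_contra hv
        have : v ∈ (A ∪ B)ᶜ := by simpa using hv
        simp [h₀] at this
      have e₁ : A \ B = Bᶜ := by
        ext v; have := hu v; simp only [mem_sdiff, mem_compl]; tauto
      have e₂ : B \ A = Aᶜ := by
        ext v; have := hu v; simp only [mem_sdiff, mem_compl]; tauto
      rw [e₁, e₂]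
      exact .inr ⟨symmetric_redFamily B hB, symmetric_redFamily A hA⟩

end Network

/-! ### Correspondence between bit lists and sets. -/

/-- The subset of `{0, …, n - 1}` with the given membership bits. -/
def toSet (n : ℕ) (A : List Bool) : Finset (Fin n) := univ.filter fun v => A.getD v false = true

theorem mem_toSet {n : ℕ} {A : List Bool} {v : Fin n} :
    v ∈ toSet n A ↔ A.getD v false = true := by simp [toSet]

theorem ofFinset_toSet {n : ℕ} {A : List Bool} (h : A.length = n) :
    Data.ofFinset (toSet n A) = Coded.code A := by
  subst h
  have : List.ofFn (fun v : Fin A.length => A.getD v false) = A := by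
    refine List.ext_getElem (by simp) fun i h₁ h₂ => ?_
    simp
  change _ = Data.ofList (A.map Data.ofBool)
  conv_rhs => rw [← this, List.map_ofFn]
  rw [Data.ofFinset]
  congr 2
  funext v
  simp only [mem_toSet, Bool.decide_eq_true, Function.comp]

theorem ofFamily_toSet {n : ℕ} {L : List (List Bool)} (h : ∀ A ∈ L, A.length = n) :
    Data.ofFamily (L.map (toSet n)) = Coded.code L := by
  rw [Data.ofFamily, List.map_map]
  exact congrArg Data.ofList (List.map_congr_left fun A hA => ofFinset_toSet (h A hA))

theorem countP_ofFn {α : Type*} {m : ℕ} (f : Fin m → α) (p : α → Bool) :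
    (List.ofFn f).countP p = #(univ.filter fun i => p (f i) = true) := by
  rw [List.ofFn_eq_map, List.countP_map, List.countP_eq_length_filter,
    ← List.toFinset_card_of_nodup ((List.nodup_finRange m).filter _)]
  congr 1; ext i; simp

namespace Network

variable {n m k : ℕ} {H : Network (Fin n) (Fin m)} {A B : List Bool}

/-- The list of the edges. -/
def edgeList (H : Network (Fin n) (Fin m)) : List FlaggedEdge :=
  List.ofFn fun e => ((H.src e : ℕ), (H.tgt e : ℕ), decide (e ∈ H.U))

/-- The prescribed input tree is literally the code of a triple, so the calculus applies to it
without conversion. -/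
theorem code_instance (H : Network (Fin n) (Fin m)) (k : ℕ) :
    Coded.code (n, k, H.edgeList) = Data.ofInstance H k := by
  change Data.node (.ofNat n) (.node (.ofNat k) (.ofList (H.edgeList.map Coded.code))) = _
  rw [edgeList, List.map_ofFn]
  rfl

theorem countP_cut (S : Finset (Fin n)) (f : ℕ → Bool) (h : ∀ v : Fin n, f v = true ↔ v ∈ S) :
    (H.edgeList.countP fun e => f e.1 != f e.2.1) = H.degree univ S := by
  rw [edgeList, countP_ofFn, degree]
  congr 1; ext e
  simp only [mem_filter, mem_univ, true_and, ← h]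
  cases f (H.src e) <;> cases f (H.tgt e) <;> simp

theorem countP_crosses : H.edgeList.countP (crosses A) = H.degree univ (toSet n A) :=
  countP_cut _ (fun v => A.getD v false) fun _ => mem_toSet.symm

theorem countP_crosses_flag :
    (H.edgeList.countP fun e => crosses A e && e.2.2) = H.degree H.U (toSet n A) := by
  rw [edgeList, countP_ofFn, degree]
  congr 1; ext e
  rw [mem_filter, mem_filter]
  simp only [mem_univ, true_and, mem_toSet, crosses]
  cases A.getD (H.src e) false <;> cases A.getD (H.tgt e) false <;> simp

theorem countP_inside : (H.edgeList.countP fun e => e.2.2 && (crosses A e &&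
    (B.getD e.1 false && B.getD e.2.1 false))) = H.inside H.U (toSet n A) (toSet n B) := by
  rw [edgeList, countP_ofFn, inside]
  congr 1; ext e
  rw [mem_filter, mem_filter]
  simp only [mem_univ, true_and, mem_inter, mem_sdiff, mem_toSet, crosses]
  cases A.getD (H.src e) false <;> cases A.getD (H.tgt e) false <;>
    cases B.getD (H.src e) false <;> cases B.getD (H.tgt e) false <;> simp

theorem countP_outside : (H.edgeList.countP fun e => e.2.2 && (crosses A e &&
    (!(B.getD e.1 false) && !(B.getD e.2.1 false)))) =
      H.inside H.U (toSet n A) (toSet n B)ᶜ := by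
  rw [edgeList, countP_ofFn, inside]
  congr 1; ext e
  rw [mem_filter, mem_filter]
  simp only [mem_univ, true_and, mem_inter, mem_sdiff, mem_compl, mem_toSet, crosses]
  cases A.getD (H.src e) false <;> cases A.getD (H.tgt e) false <;>
    cases B.getD (H.src e) false <;> cases B.getD (H.tgt e) false <;> simp

theorem redSide_iff : redSide H.edgeList A B = true ↔ H.HasRedSide (toSet n A) (toSet n B) := by
  rw [redSide, countP_inside, countP_outside, hasRedSide_iff]; simp

theorem any_range (f : ℕ → Bool) :
    (List.range n).any f = true ↔ ∃ v : Fin n, f v = true := by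
  rw [List.any_eq_true]
  exact ⟨fun ⟨v, h₁, h₂⟩ => ⟨⟨v, List.mem_range.1 h₁⟩, h₂⟩,
    fun ⟨v, h⟩ => ⟨v, List.mem_range.2 v.2, h⟩⟩

theorem crossing_iff : crossing n A B = true ↔ Cross (toSet n A) (toSet n B) := by
  rw [crossing, Bool.and_eq_true, Bool.and_eq_true, Bool.and_eq_true, any_range, any_range,
    any_range, any_range, Cross]
  simp only [Finset.Nonempty, mem_inter, mem_sdiff, mem_compl, mem_union, mem_toSet, and_assoc]
  simp

theorem any_iff (hA : A.length = n) (f : Bool → Bool) :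
    A.any f = true ↔ ∃ v : Fin n, f (A.getD v false) = true := by
  subst hA
  rw [List.any_eq_true]
  constructor
  · rintro ⟨b, hb, h⟩
    obtain ⟨i, hi, rfl⟩ := List.getElem_of_mem hb
    exact ⟨⟨i, hi⟩, by rwa [List.getD_eq_getElem _ _ hi]⟩
  · rintro ⟨v, h⟩
    exact ⟨_, getD_mem v.2, h⟩

theorem isTight_iff (hA : A.length = n) :
    isTight k H.edgeList A = true ↔ toSet n A ∈ H.tightCuts k 2 := by
  rw [isTight, mem_tightCuts, Bool.and_eq_true, Bool.and_eq_true, Bool.and_eq_true, any_iff hA,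
    any_iff hA, countP_crosses, countP_crosses_flag]
  simp only [Finset.Nonempty, mem_compl, mem_toSet, decide_eq_true_eq, and_assoc]
  simp

theorem length_of_mem_tightList (hA : A ∈ tightList n k H.edgeList) : A.length = n :=
  length_of_mem_sums A (List.mem_filter.1 hA).1

theorem FlexConnected.exists_mem_candidates (h : H.FlexConnected k 1) (hk : 0 < k)
    {S : Finset (Fin n)} (hS : S ∈ H.tightCuts k 2) :
    ∃ A ∈ candidates n k H.edgeList, toSet n A = S := by
  obtain ⟨⟨a, ha⟩, ⟨b, hb⟩, h₁, -⟩ := mem_tightCuts.1 hS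
  let f : ℕ → Bool := fun v => if hv : v < n then decide (⟨v, hv⟩ ∈ S) else false
  have hf : ∀ v : Fin n, f v = true ↔ v ∈ S := fun v => by simp [f]
  have hf' : ∀ v : Fin n, f v = false ↔ v ∉ S := fun v => by simp [f]
  obtain ⟨A, hA, hAS⟩ := exists_candidate (n := n) (es := H.edgeList) hk
    (fun e he => by
      obtain ⟨i, rfl⟩ := List.mem_ofFn.1 he
      exact ⟨(H.src i).2, (H.tgt i).2⟩)
    (fun g ⟨u, hu, hgu⟩ ⟨v, hv, hgv⟩ => by
      rw [countP_cut (univ.filter fun v : Fin n => g v = true) g (by simp)]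
      exact (h.degree_cases ⟨⟨u, hu⟩, by simpa using hgu⟩ ⟨⟨v, hv⟩, by simpa using hgv⟩).1)
    (S := f) ⟨a, a.2, (hf a).2 ha⟩ ⟨b, b.2, (hf' b).2 (mem_compl.1 hb)⟩
    (by rw [countP_cut S f hf, h₁])
  refine ⟨A, hA, ?_⟩
  ext v
  rw [mem_toSet, hAS v v.2, hf]

/-- Completeness comes from the candidate list, soundness from the filter. Quantifying over
`tightList` is therefore quantifying over all tight cuts, which makes the two later filters correct.
-/
theorem FlexConnected.mem_tightCuts_iff (h : H.FlexConnected k 1) (hk : 0 < k)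
    {S : Finset (Fin n)} :
    S ∈ H.tightCuts k 2 ↔ ∃ A ∈ tightList n k H.edgeList, toSet n A = S := by
  constructor
  · intro hS
    obtain ⟨A, hA, rfl⟩ := h.exists_mem_candidates hk hS
    exact ⟨A, List.mem_filter.2 ⟨hA, (isTight_iff (length_of_mem_sums A hA)).2 hS⟩, rfl⟩
  · rintro ⟨A, hA, rfl⟩
    exact (isTight_iff (length_of_mem_tightList hA)).1 (List.mem_filter.1 hA).2

theorem FlexConnected.mem_redList (h : H.FlexConnected k 1) (hk : 0 < k) :
    {S | S ∈ (redList n k H.edgeList).map (toSet n)} = H.redFamily k := by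
  ext S
  change S ∈ (redList n k H.edgeList).map (toSet n) ↔ _ ∧ _
  simp only [redList, List.mem_map, List.mem_filter, List.all_eq_true, Bool.or_eq_true,
    Bool.not_eq_true', redSide_iff, h.mem_tightCuts_iff hk]
  constructor
  · rintro ⟨A, ⟨hA, h'⟩, rfl⟩
    refine ⟨⟨A, hA, rfl⟩, ?_⟩
    rintro _ ⟨B, hB, rfl⟩ hAB
    refine (h' B hB).resolve_left ?_
    rw [crossing_iff.2 hAB]; simp
  · rintro ⟨⟨A, hA, rfl⟩, h'⟩
    refine ⟨A, ⟨hA, fun B hB => ?_⟩, rfl⟩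
    rw [or_iff_not_imp_left, Bool.not_eq_false, crossing_iff]
    exact h' _ ⟨B, hB, rfl⟩

theorem FlexConnected.mem_blueList (h : H.FlexConnected k 1) (hk : 0 < k) :
    {S | S ∈ (blueList n k H.edgeList).map (toSet n)} = H.blueFamily k := by
  ext S
  change S ∈ (blueList n k H.edgeList).map (toSet n) ↔ _ ∧ _ ∧ _
  simp only [blueList, List.mem_map, List.mem_filter, List.all_eq_true, Bool.or_eq_true,
    Bool.and_eq_true, decide_eq_true_eq, countP_crosses_flag, card_cut_inter,
    Bool.not_eq_true', ← Bool.not_eq_true, redSide_iff, h.mem_tightCuts_iff hk]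
  constructor
  · rintro ⟨A, ⟨hA, h₂, h'⟩, rfl⟩
    refine ⟨⟨A, hA, rfl⟩, h₂, ?_⟩
    rintro _ ⟨B, hB, rfl⟩ hAB
    exact (h' B hB).resolve_left fun hn => hn (crossing_iff.2 hAB)
  · rintro ⟨⟨A, hA, rfl⟩, h₂, h'⟩
    refine ⟨A, ⟨hA, h₂, fun B hB => ?_⟩, rfl⟩
    rw [or_iff_not_imp_left, not_not, crossing_iff]
    exact h' _ ⟨B, hB, rfl⟩

end Network

/-! ### The program and the final assembly. -/

theorem code_pair {α β : Type} [Coded α] [Coded β] (a : α) (b : β) :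
    Coded.code (a, b) = .node (Coded.code a) (Coded.code b) := rfl

theorem exists_program : PolyTime fun x : ℕ × ℕ × List FlaggedEdge =>
    (redList x.1 x.2.1 x.2.2, blueList x.1 x.2.1 x.2.2) :=
  .pair (.redList (by fun_prop) (by fun_prop) (by fun_prop))
    (.blueList (by fun_prop) (by fun_prop) (by fun_prop))

end FlexCut

theorem lemmal :
    ∃ (P : FlexCut.Prog) (p : Polynomial ℕ),
      ∀ (n m k : ℕ) (H : FlexCut.Network (Fin n) (Fin m)), Odd k → H.FlexConnected k 1 →
        ∃ (L' L'' : List (Finset (Fin n))) (t : ℕ),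
          FlexCut.Run P (FlexCut.Data.ofInstance H k)
            (.node (FlexCut.Data.ofFamily L') (FlexCut.Data.ofFamily L'')) t ∧
          t ≤ p.eval (FlexCut.Data.ofInstance H k).size ∧
          {S | S ∈ L'} ∪ {S | S ∈ L''} = H.tightCuts k 2 ∧
          FlexCut.Uncrossable {S | S ∈ L'} ∧
          FlexCut.SymmetricFamily {S | S ∈ L''} ∧
          FlexCut.ProperCrossingFamily {S | S ∈ L''} ∧
          (∀ A ∈ L', ∀ B ∈ H.tightCuts k 2, FlexCut.Cross A B → H.HasRedSide A B) ∧
          (∀ A ∈ L'', (H.cut A ∩ H.U).card = 2) ∧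
          (∀ A ∈ L'', ∀ B ∈ H.tightCuts k 2, FlexCut.Cross A B → H.TwoBlueSides A B) := by
  obtain ⟨P, p, hP⟩ := FlexCut.exists_program
  refine ⟨P, p, fun n m k H hk h => ?_⟩
  obtain ⟨t, h₁, h₂⟩ := hP (n, k, H.edgeList)
  have hred := h.mem_redList hk.pos
  have hblue := h.mem_blueList hk.pos
  have hred' {A} (hA : A ∈ (FlexCut.redList n k H.edgeList).map (FlexCut.toSet n)) :
      A ∈ H.redFamily k := by rw [← hred]; exact hA
  have hblue' {A} (hA : A ∈ (FlexCut.blueList n k H.edgeList).map (FlexCut.toSet n)) :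
      A ∈ H.blueFamily k := by rw [← hblue]; exact hA
  refine ⟨(FlexCut.redList n k H.edgeList).map (FlexCut.toSet n),
    (FlexCut.blueList n k H.edgeList).map (FlexCut.toSet n), t, ?_, ?_, ?_, ?_, ?_, ?_,
    fun A hA => (hred' hA).2, fun A hA => (hblue' hA).2.1, fun A hA B hB hAB =>
      h.twoBlueSides hk (hblue' hA).1 hB hAB ((hblue' hA).2.2 B hB hAB)⟩
  · rw [FlexCut.Network.code_instance] at h₁
    have e₁ := FlexCut.ofFamily_toSet (n := n) (L := FlexCut.redList n k H.edgeList)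
      fun A hA => FlexCut.Network.length_of_mem_tightList (List.mem_filter.1 hA).1
    have e₂ := FlexCut.ofFamily_toSet (n := n) (L := FlexCut.blueList n k H.edgeList)
      fun A hA => FlexCut.Network.length_of_mem_tightList (List.mem_filter.1 hA).1
    rw [e₁, e₂, ← FlexCut.code_pair]
    exact h₁
  · rwa [FlexCut.csize, FlexCut.Network.code_instance] at h₂
  · rw [hred, hblue, h.union_families hk]
  · rw [hred]; exact h.uncrossable_redFamily hk
  · rw [hblue]; exact FlexCut.Network.symmetric_blueFamily
  · rw [hblue]; exact h.properCrossing_blueFamily hk
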